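/- Let $\Gamma$ be a group. Graphs may have loops and parallel edges, and edge sets are finite. A $\Gamma$-gain-graph $\Omega=(G,\sigma)$ is a graph $G$ with a function $\sigma$ assigning an element $\sigma(e,x,y)\in\Gamma$ to each edge $e$ with ends $x,y$ (where $x=y$ if $e$ is a loop), such that $\sigma(e,x,y)=\sigma(e,y,x)^{-1}$ if $x\neq y$. The gain $\sigma(W)$ of a walk $W$ is the product of the gains of its edges in the order and direction of traversal. A cycle $C$ is balanced if $\sigma(C)=1$, and an unbalanced loop at $x$ is a loop edge $e$ with $\sigma(e,x,x)\ne 1$. For a set $X$ of edges, $G[X]$ is the subgraph with edge set $X$ whose vertices are those incident with an edge of $X$. A bicycle is a set $X$ of edges that is minimal such that $G[X]$ is connected and contains at least two cycles. The frame matroid $F(\Omega)$ is the matroid on $E(G)$ whose circuits are the balanced cycles and the bicycles that contain no balanced cycle. Let $M_1,M_2$ be matroids on finite sets $E_1,E_2$ with rank functions $r_1,r_2$, let $\ell=E_1\cap E_2$, and suppose that $M_1|\ell=M_2|\ell=N$ is modular, that is, $r_N(F)+r_N(F')=r_N(F\cap F')+r_N(F\cup F')$ for all flats $F,F'$ of $N$.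 The proper amalgam of $M_1$ and $M_2$ over $\ell$ is the matroid $M$ on $E_1\cup E_2$ with $M|E_1=M_1$ and $M|E_2=M_2$ in which every $X\subseteq E_1\cup E_2$ has rank $$\min\{r_1(Y\cap E_1)+r_2(Y\cap E_2)-r_N(Y\cap \ell) : X\subseteq Y\subseteq E_1\cup E_2\}.$$ **Lemma.** For $i=1,2$ let $\Omega_i=(G_i,\sigma_i)$ be a $\Gamma$-gain-graph. Assume that $V(G_1)\cap V(G_2)=\{u,v\}$ with $u\ne v$, and let $\ell=E(G_1)\cap E(G_2)$. Assume that 1. $G_1[\ell]=G_2[\ell]$; 2. $\sigma_1(e,x,y)=\sigma_2(e,x,y)$ whenever $(e,x,y)$ is in the domains of both $\sigma_1$ and $\sigma_2$; 3. $\ell$ contains an unbalanced loop at $u$ and an unbalanced loop at $v$; 4. whenever $P_i$ is a path of $G_i$ from $u$ to $v$ for $i=1,2$ and $\sigma_1(P_1)=\sigma_2(P_2)$, there is a non-loop edge $e\in\ell$ such that $\sigma_1(e,u,v)=\sigma_2(e,u,v)=\sigma_1(P_1)=\sigma_2(P_2)$. Let $\Omega_1\oplus_{uv}\Omega_2$ be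 the gain-graph with vertex set $V(G_1)\cup V(G_2)$, edge set $E(G_1)\cup E(G_2)$, the incidences of $G_1$ and $G_2$, and gains $\sigma_1\cup\sigma_2$. Then the frame matroids $F(\Omega_1)$, $F(\Omega_2)$ and $F(\Omega_1\oplus_{uv}\Omega_2)$ exist, $F(\Omega_1)|\ell=F(\Omega_2)|\ell$ is modular, and $F(\Omega_1\oplus_{uv}\Omega_2)$ is the proper amalgam of $F(\Omega_1)$ and $F(\Omega_2)$ over $\ell$. -/

import Mathlib

open scoped Graph

namespace Graph

variable {α β : Type*}

/-- `G.edgeInduced X` is the subgraph `G[X]`: its edges are the edges of `G` in `X`, and its vertices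
are the vertices of `G` that are incident with at least one such edge. -/
def edgeInduced (G : Graph α β) (X : Set β) : Graph α β where
  vertexSet := {x | ∃ e ∈ X, G.Inc e x}
  edgeSet := E(G) ∩ X
  IsLink e x y := e ∈ X ∧ G.IsLink e x y
  isLink_symm _ _ := { symm _ _ h := ⟨h.1, h.2.symm⟩ }
  eq_or_eq_of_isLink_of_isLink _ _ _ _ _ h h' := h.2.left_eq_or_eq h'.2
  edge_mem_iff_exists_isLink e :=
    ⟨fun h ↦ by
      obtain ⟨x, y, hxy⟩ := G.exists_isLink_of_mem_edgeSet h.1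
      exact ⟨x, y, h.2, hxy⟩,
     fun ⟨_, _, h⟩ ↦ ⟨h.2.edge_mem, h.1⟩⟩
  left_mem_of_isLink e _ y h := ⟨e, h.1, y, h.2⟩

/-- Walks `v₀, e₀, v₁, e₁, …, vₙ` in a graph, with their first and last vertex. -/
inductive Walk (G : Graph α β) : α → α → Type _
  | nil {x : α} (hx : x ∈ V(G)) : Walk G x x
  | cons {x y z : α} (e : β) (h : G.IsLink e x y) (w : Walk G y z) : Walk G x z

namespace Walk

variable {G : Graph α β}

/-- The list `v₀, v₁, …, vₙ` of vertices of a walk. -/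
def vertices : {x y : α} → G.Walk x y → List α
  | x, _, .nil _ => [x]
  | x, _, .cons _ _ w => x :: w.vertices

/-- The list `e₀, e₁, …` of edges of a walk. -/
def edges : {x y : α} → G.Walk x y → List β
  | _, _, .nil _ => []
  | _, _, .cons e _ w => e :: w.edges

/-- A path is a walk without repeated vertices. -/
def IsPath {x y : α} (w : G.Walk x y) : Prop := w.vertices.Nodup

/-- A walk that goes once around a cycle: a closed walk with at least one edge that has no repeated
edge and whose only repeated vertex is the common first and last one. Loops are cycles with one
edge, and two parallel edges form a cycle with two edges. -/
structure IsCycle {x : α} (w : G.Walk x x) : Prop where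
  edges_ne_nil : w.edges ≠ []
  edges_nodup : w.edges.Nodup
  vertices_tail_nodup : w.vertices.tail.Nodup

end Walk

/-- `C` is the edge set of a cycle of `G`. -/
def IsCycleSet (G : Graph α β) (C : Set β) : Prop :=
  ∃ (x : α) (w : G.Walk x x), w.IsCycle ∧ C = {e | e ∈ w.edges}

/-- A connected graph: it has a vertex, and any two of its vertices are joined by a walk. -/
def IsConnected (G : Graph α β) : Prop :=
  V(G).Nonempty ∧ ∀ x ∈ V(G), ∀ y ∈ V(G), Nonempty (G.Walk x y)

/-- A bicycle: a set `X` of edges that is minimal such that `G[X]` is connected and contains at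
least two cycles. -/
def IsBicycle (G : Graph α β) (X : Set β) : Prop :=
  Minimal (fun Y : Set β ↦ Y ⊆ E(G) ∧ (G.edgeInduced Y).IsConnected ∧
    ∃ C₁ C₂ : Set β, C₁ ≠ C₂ ∧ (G.edgeInduced Y).IsCycleSet C₁ ∧
      (G.edgeInduced Y).IsCycleSet C₂) X

lemma isLink_of_edgeInduced_eq {G₁ G₂ : Graph α β}
    (h : G₁.edgeInduced (E(G₁) ∩ E(G₂)) = G₂.edgeInduced (E(G₁) ∩ E(G₂)))
    {e : β} {x y : α} (h₁ : G₁.IsLink e x y) (h₂ : e ∈ E(G₂)) : G₂.IsLink e x y := by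
  have h3 : (G₁.edgeInduced (E(G₁) ∩ E(G₂))).IsLink e x y := ⟨⟨h₁.edge_mem, h₂⟩, h₁⟩
  rw [h] at h3
  exact h3.2

/-- The union `G₁ ⊕ G₂` of two graphs with `G₁[ℓ] = G₂[ℓ]`, where `ℓ` is the set of common edges:
its vertices, edges and incidences are those of `G₁` together with those of `G₂`. -/
def amalgam (G₁ G₂ : Graph α β)
    (h : G₁.edgeInduced (E(G₁) ∩ E(G₂)) = G₂.edgeInduced (E(G₁) ∩ E(G₂))) : Graph α β where
  vertexSet := V(G₁) ∪ V(G₂)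
  edgeSet := E(G₁) ∪ E(G₂)
  IsLink e x y := G₁.IsLink e x y ∨ G₂.IsLink e x y
  isLink_symm _ _ := { symm _ _ h := h.imp (·.symm) (·.symm) }
  eq_or_eq_of_isLink_of_isLink e x y v w h₁ h₂ := by
    rcases h₁ with h₁ | h₁ <;> rcases h₂ with h₂ | h₂
    · exact h₁.left_eq_or_eq h₂
    · exact (isLink_of_edgeInduced_eq h h₁ h₂.edge_mem).left_eq_or_eq h₂
    · exact h₁.left_eq_or_eq (isLink_of_edgeInduced_eq h h₂ h₁.edge_mem)
    · exact h₁.left_eq_or_eq h₂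
  edge_mem_iff_exists_isLink e := by
    simp only [Set.mem_union, edge_mem_iff_exists_isLink, ← exists_or]
  left_mem_of_isLink e x y h := h.imp (·.left_mem) (·.left_mem)

end Graph

/-- A `Γ`-gain-graph. The gain `gain e x y` has a meaning only if `e` is an edge with ends `x` and
`y` (with `x = y` if `e` is a loop); its other values are irrelevant. -/
structure GainGraph (α β Γ : Type*) [Group Γ] where
  graph : Graph α β
  gain : β → α → α → Γ
  gain_symm : ∀ ⦃e x y⦄, graph.IsLink e x y → x ≠ y → gain e x y = (gain e y x)⁻¹

namespace GainGraph

variable {α β Γ : Type*} [Group Γ]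

/-- The gain of a walk is the product of the gains of its edges, in the order and direction in which
they are traversed. -/
def walkGain (Ω : GainGraph α β Γ) : {x y : α} → Ω.graph.Walk x y → Γ
  | _, _, .nil _ => 1
  | _, _, .cons (x := x) (y := y) e _ w => Ω.gain e x y * Ω.walkGain w

/-- `e` is an unbalanced loop edge at the vertex `x`. -/
def IsUnbalancedLoop (Ω : GainGraph α β Γ) (e : β) (x : α) : Prop :=
  Ω.graph.IsLoopAt e x ∧ Ω.gain e x x ≠ 1

/-- `C` is the edge set of a balanced cycle, that is, of a cycle with gain `1`. (Whether the gain
is `1` does not depend on the starting point and direction of the cycle.) -/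
def IsBalancedCycle (Ω : GainGraph α β Γ) (C : Set β) : Prop :=
  ∃ (x : α) (w : Ω.graph.Walk x x), w.IsCycle ∧ Ω.walkGain w = 1 ∧ C = {e | e ∈ w.edges}

/-- `M` is the frame matroid `F(Ω)`: its ground set is the edge set, and its circuits are the
balanced cycles and the bicycles that contain no balanced cycle. -/
structure IsFrameMatroid (Ω : GainGraph α β Γ) (M : Matroid β) : Prop where
  ground_eq : M.E = E(Ω.graph)
  isCircuit_iff : ∀ C : Set β, M.IsCircuit C ↔
    (Ω.IsBalancedCycle C ∨ (Ω.graph.IsBicycle C ∧ ∀ D ⊆ C, ¬ Ω.IsBalancedCycle D))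

/-- There is at most one frame matroid of a gain-graph. -/
lemma IsFrameMatroid.unique {Ω : GainGraph α β Γ} {M M' : Matroid β}
    (h : Ω.IsFrameMatroid M) (h' : Ω.IsFrameMatroid M') : M = M' :=
  Matroid.ext_isCircuit (h.ground_eq.trans h'.ground_eq.symm)
    fun C _ ↦ (h.isCircuit_iff C).trans (h'.isCircuit_iff C).symm

/-- The conditions under which the gain-graph amalgam of `Ω₁` and `Ω₂` with base `{u, v}` is
defined. -/
structure Amalgamable (Ω₁ Ω₂ : GainGraph α β Γ) (u v : α) : Prop where
  vertexSet_inter : V(Ω₁.graph) ∩ V(Ω₂.graph) = {u, v}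
  edgeInduced_eq : Ω₁.graph.edgeInduced (E(Ω₁.graph) ∩ E(Ω₂.graph)) =
    Ω₂.graph.edgeInduced (E(Ω₁.graph) ∩ E(Ω₂.graph))
  gain_eq : ∀ e x y, Ω₁.graph.IsLink e x y → Ω₂.graph.IsLink e x y →
    Ω₁.gain e x y = Ω₂.gain e x y

open Classical in
/-- The gain-graph amalgam of `Ω₁` and `Ω₂`: the graph is the amalgam of the two graphs and the
gaining is the union of the two gainings (which agree on common edges). -/
noncomputable def amalgam (Ω₁ Ω₂ : GainGraph α β Γ) {u v : α} (h : Ω₁.Amalgamable Ω₂ u v) :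
    GainGraph α β Γ where
  graph := Ω₁.graph.amalgam Ω₂.graph h.edgeInduced_eq
  gain e x y := if Ω₁.graph.IsLink e x y then Ω₁.gain e x y else Ω₂.gain e x y
  gain_symm e x y hxy hne := by
    by_cases h₁ : Ω₁.graph.IsLink e x y
    · rw [if_pos h₁, if_pos h₁.symm, Ω₁.gain_symm h₁ hne]
    · rw [if_neg h₁, if_neg fun h' ↦ h₁ h'.symm]
      exact Ω₂.gain_symm (hxy.resolve_left h₁) hne

end GainGraph

namespace Matroid

variable {β : Type*}

/-- `M` is an amalgam of `M₁` and `M₂`. -/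
structure IsAmalgam (M₁ M₂ M : Matroid β) : Prop where
  ground_eq : M.E = M₁.E ∪ M₂.E
  restrict_left : M ↾ M₁.E = M₁
  restrict_right : M ↾ M₂.E = M₂

/-- A matroid is modular if `r(F) + r(F') = r(F ∩ F') + r(F ∪ F')` for all flats `F` and `F'`. -/
def IsModular (M : Matroid β) : Prop :=
  ∀ F F' : Set β, M.IsFlat F → M.IsFlat F' →
    M.eRk F + M.eRk F' = M.eRk (F ∩ F') + M.eRk (F ∪ F')

/-- `M` is the proper amalgam of the matroids `M₁` and `M₂` (with finite ground sets) over
`ℓ = E₁ ∩ E₂`. The two matroids have the same restriction `N` to `ℓ`, this restriction is modular,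
and `M` is the amalgam of `M₁` and `M₂` in which the rank of `X ⊆ E₁ ∪ E₂` is the minimum of
`r₁(Y ∩ E₁) + r₂(Y ∩ E₂) - r_N(Y ∩ ℓ)` over all `Y` with `X ⊆ Y ⊆ E₁ ∪ E₂`. The last two fields
say this with the subtracted term moved to the other side. -/
structure IsProperAmalgam (M₁ M₂ M : Matroid β) : Prop extends IsAmalgam M₁ M₂ M where
  finite : M.E.Finite
  restrict_eq : M₁ ↾ (M₁.E ∩ M₂.E) = M₂ ↾ (M₁.E ∩ M₂.E)
  isModular : (M₁ ↾ (M₁.E ∩ M₂.E)).IsModular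
  rank_le : ∀ X Y : Set β, X ⊆ Y → Y ⊆ M₁.E ∪ M₂.E →
    M.eRk X + (M₁ ↾ (M₁.E ∩ M₂.E)).eRk (Y ∩ (M₁.E ∩ M₂.E)) ≤
      M₁.eRk (Y ∩ M₁.E) + M₂.eRk (Y ∩ M₂.E)
  exists_rank_eq : ∀ X : Set β, X ⊆ M₁.E ∪ M₂.E → ∃ Y : Set β, X ⊆ Y ∧ Y ⊆ M₁.E ∪ M₂.E ∧
    M.eRk X + (M₁ ↾ (M₁.E ∩ M₂.E)).eRk (Y ∩ (M₁.E ∩ M₂.E)) =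
      M₁.eRk (Y ∩ M₁.E) + M₂.eRk (Y ∩ M₂.E)

end Matroid

/-! Write `Ω` for the amalgamated gain-graph and `ℓ` for the set of common edges. The frame matroid
is defined through its closure operator: an edge from `x` to `y` with gain `g` lies in the closure
of `X` when `X` contains a walk from `x` to `y` with gain `g`, or when both `x` and `y` lie in
unbalanced components of `X`. This operator has the exchange property (`closure_exchange`), and the
circuits of the resulting matroid are the prescribed ones (`isFrameMatroid_frameMatroid`). The
closure of `X` only depends on walks in `X`, so `F(Ω₁)` and `F(Ω₂)` are restrictions of `M = F(Ω)`.

The unbalanced loops at `u` and `v` span `ℓ`, so `M` restricted to `ℓ` has rank at most two and is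
modular. The rank inequality for every `Y` is submodularity of `M`. Equality is attained at the
closure of `X`, because a flat `Y` satisfies `r(Y) + r(Y ∩ ℓ) = r(Y ∩ E₁) + r(Y ∩ E₂)`
(`IsGluing.eRk_add_eRk`). Indeed, a walk in `Y` leaves one side only through `u` and `v`, and what
its excursion contributes is already supplied by `Y ∩ ℓ`: by the loops if the excursion lies in an
unbalanced component, and otherwise, when both sides connect `u` to `v`, by the edge from the path
hypothesis. If only one side connects `u` to `v`, excursions into the other side are the ones to
replace. -/

/-! ### Matroids from closure operators with exchange -/

namespace Matroid

variable {β : Type*} {E : Set β} {cl : Set β → Set β}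

/-- The matroid on a finite set `E` given by a closure operator with the exchange property: a set
is independent if none of its elements is in the closure of the others. -/
def ofExchangeClosure (hE : E.Finite) (cl : Set β → Set β) (cl_mono : Monotone cl)
    (subset_cl : ∀ X, X ⊆ E → X ⊆ cl X) (cl_cl : ∀ X, cl (cl X) ⊆ cl X)
    (exchange : ∀ X e f, f ∈ E → e ∈ cl (insert f X) → e ∉ cl X → f ∈ cl (insert e X)) :
    Matroid β :=
  have indep_insert : ∀ I x, (I ⊆ E ∧ ∀ e ∈ I, e ∉ cl (I \ {e})) → x ∈ E → x ∉ cl I →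
      (insert x I ⊆ E ∧ ∀ e ∈ insert x I, e ∉ cl (insert x I \ {e})) := by
    rintro I x ⟨hI, hI'⟩ hxE hx
    refine ⟨Set.insert_subset hxE hI, ?_⟩
    rintro e (rfl | he) hcl
    · exact hx (cl_mono (by simp) hcl)
    · have hne : x ≠ e := by
        rintro rfl
        exact hx (subset_cl I hI he)
      rw [Set.insert_sdiff_of_notMem _ (by simpa using hne)] at hcl
      have := exchange _ _ _ hxE hcl (hI' e he)
      rw [Set.insert_sdiff_singleton, Set.insert_eq_of_mem he] at this
      exact hx this
  IndepMatroid.matroid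
    { E := E
      Indep := fun I ↦ I ⊆ E ∧ ∀ e ∈ I, e ∉ cl (I \ {e})
      indep_empty := by simp
      indep_subset := fun I J hJ hIJ ↦ ⟨hIJ.trans hJ.1, fun e he h ↦
        hJ.2 e (hIJ he) (cl_mono (Set.sdiff_subset_sdiff_left hIJ) h)⟩
      indep_aug := by
        intro I B hI hImax hB
        by_contra hcon
        -- If no element of `B` extends `I`, then `I` spans the maximal independent set `B`, hence
        -- `E`, and is itself maximal.
        have hBI : B ⊆ cl I := by
          intro x hx
          by_cases hxI : x ∈ I
          · exact subset_cl I hI.1 hxI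
          by_contra hxcl
          exact hcon ⟨x, ⟨hx, hxI⟩, indep_insert I x hI (hB.prop.1 hx) hxcl⟩
        have hEB : E ⊆ cl B := by
          intro x hx
          by_contra hxcl
          have := hB.le_of_ge (indep_insert B x hB.prop hx hxcl) (Set.subset_insert x B)
          exact hxcl (subset_cl B hB.prop.1 (this (Set.mem_insert x B)))
        have hEI : E ⊆ cl I := hEB.trans ((cl_mono hBI).trans (cl_cl I))
        refine hImax ⟨hI, fun J hJ hIJ x hx ↦ ?_⟩
        by_contra hxI
        exact hJ.2 x hx (cl_mono (Set.subset_sdiff_singleton hIJ hxI) (hEI (hJ.1 hx)))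
      indep_maximal := by
        intro X hX I hI hIX
        have hfin : {J | J ⊆ X ∧ (J ⊆ E ∧ ∀ e ∈ J, e ∉ cl (J \ {e}))}.Finite :=
          (hE.subset hX).finite_subsets.subset fun J hJ ↦ hJ.1
        obtain ⟨J, hIJ, hJ⟩ := hfin.exists_le_maximal ⟨hIX, hI⟩
        exact ⟨J, hIJ, ⟨hJ.prop.2, hJ.prop.1⟩, fun K hK hJK ↦ hJ.le_of_ge ⟨hK.2, hK.1⟩ hJK⟩
      subset_ground := fun I hI ↦ hI.1 }

section

variable (hE : E.Finite) (cl_mono : Monotone cl)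
    (subset_cl : ∀ X, X ⊆ E → X ⊆ cl X) (cl_cl : ∀ X, cl (cl X) ⊆ cl X)
    (exchange : ∀ X e f, f ∈ E → e ∈ cl (insert f X) → e ∉ cl X → f ∈ cl (insert e X))

/-- For an independent set, exchange turns dependence of `insert e I` into `e ∈ cl I`. The general
case follows by passing to a basis. -/
lemma ofExchangeClosure_closure (cl_subset : ∀ X, cl X ⊆ E) {X : Set β} (hX : X ⊆ E) :
    (ofExchangeClosure hE cl cl_mono subset_cl cl_cl exchange).closure X = cl X := by
  set M := ofExchangeClosure hE cl cl_mono subset_cl cl_cl exchange with hM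
  have hindep : ∀ I, M.Indep I ↔ I ⊆ E ∧ ∀ e ∈ I, e ∉ cl (I \ {e}) := fun _ ↦ Iff.rfl
  have key : ∀ I, M.Indep I → M.closure I = cl I := by
    intro I hI
    ext e
    by_cases heI : e ∈ I
    · exact iff_of_true (M.mem_closure_of_mem heI hI.subset_ground)
        (subset_cl I hI.subset_ground heI)
    rw [hI.mem_closure_iff_of_notMem heI, dep_iff, hindep]
    constructor
    · rintro ⟨h, heE⟩
      by_contra hcl
      refine h ⟨heE, ?_⟩
      rintro f (rfl | hf) hfcl
      · exact hcl (cl_mono (by simp) hfcl)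
      · have hne : e ≠ f := by
          rintro rfl
          exact heI hf
        rw [Set.insert_sdiff_of_notMem _ (by simpa using hne)] at hfcl
        have := exchange _ _ _ (heE (Set.mem_insert _ _)) hfcl (((hindep I).1 hI).2 f hf)
        rw [Set.insert_sdiff_singleton, Set.insert_eq_of_mem hf] at this
        exact hcl this
    · intro h
      refine ⟨fun h' ↦ h'.2 e (Set.mem_insert _ _) (cl_mono ?_ h), ?_⟩
      · exact Set.subset_sdiff_singleton (Set.subset_insert _ _) heI
      · exact Set.insert_subset (cl_subset I h) hI.subset_ground
  obtain ⟨I, hI⟩ := M.exists_isBasis X hX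
  have hXI : X ⊆ cl I := key I hI.indep ▸ hI.subset_closure
  rw [← hI.closure_eq_closure, key I hI.indep]
  exact (cl_mono hI.subset).antisymm ((cl_mono hXI).trans (cl_cl I))

end

end Matroid

/-! ### The closure operator of a gain-graph -/

namespace GainGraph

variable {α β Γ : Type*} [Group Γ] {Ω : GainGraph α β Γ} {X Y : Set β} {x y z : α} {g h : Γ}
  {e f : β}

/-- `Ω.Joins X x y g` means that one can get from `x` to `y` with gain `g` along edges in `X`. -/
inductive Joins (Ω : GainGraph α β Γ) (X : Set β) (x : α) : α → Γ → Prop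
  | refl : Joins Ω X x x 1
  | step {y z : α} {g : Γ} {e : β} (h : Joins Ω X x y g) (he : e ∈ X)
      (hl : Ω.graph.IsLink e y z) : Joins Ω X x z (g * Ω.gain e y z)
  -- Needed for loops: `gain_symm` does not apply to them, and reversing a walk has to invert the
  -- gain of a loop as well.
  | step_inv {y z : α} {g : Γ} {e : β} (h : Joins Ω X x y g) (he : e ∈ X)
      (hl : Ω.graph.IsLink e z y) : Joins Ω X x z (g * (Ω.gain e z y)⁻¹)

namespace Joins

lemma single (he : e ∈ X) (hl : Ω.graph.IsLink e x y) : Ω.Joins X x y (Ω.gain e x y) := by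
  simpa using Joins.refl.step he hl

lemma single_inv (he : e ∈ X) (hl : Ω.graph.IsLink e x y) :
    Ω.Joins X y x (Ω.gain e x y)⁻¹ := by
  simpa using Joins.refl.step_inv he hl

lemma trans (h₁ : Ω.Joins X x y g) (h₂ : Ω.Joins X y z h) : Ω.Joins X x z (g * h) := by
  induction h₂ with
  | refl => simpa
  | step _ he hl ih => simpa [mul_assoc] using ih.step he hl
  | step_inv _ he hl ih => simpa [mul_assoc] using ih.step_inv he hl

lemma symm (h₁ : Ω.Joins X x y g) : Ω.Joins X y x g⁻¹ := by
  induction h₁ with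
  | refl => simpa using Joins.refl
  | step _ he hl ih => simpa using (single_inv he hl).trans ih
  | step_inv _ he hl ih => simpa using (single he hl).trans ih

lemma mono (h₁ : Ω.Joins X x y g) (hXY : X ⊆ Y) : Ω.Joins Y x y g := by
  induction h₁ with
  | refl => exact .refl
  | step _ he hl ih => exact ih.step (hXY he) hl
  | step_inv _ he hl ih => exact ih.step_inv (hXY he) hl

end Joins

/-- One can get from `x` to `y` along edges in `X`. -/
def Reach (Ω : GainGraph α β Γ) (X : Set β) (x y : α) : Prop := ∃ g, Ω.Joins X x y g

namespace Reach

lemma refl : Ω.Reach X x x := ⟨1, .refl⟩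

lemma trans (h₁ : Ω.Reach X x y) (h₂ : Ω.Reach X y z) : Ω.Reach X x z :=
  ⟨_, h₁.choose_spec.trans h₂.choose_spec⟩

lemma symm (h₁ : Ω.Reach X x y) : Ω.Reach X y x := ⟨_, h₁.choose_spec.symm⟩

lemma mono (h₁ : Ω.Reach X x y) (hXY : X ⊆ Y) : Ω.Reach Y x y := ⟨_, h₁.choose_spec.mono hXY⟩

lemma single (he : e ∈ X) (hl : Ω.graph.IsLink e x y) : Ω.Reach X x y := ⟨_, .single he hl⟩

end Reach

/-- `x` is a vertex of an unbalanced component of `X`. -/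
def UnbalancedAt (Ω : GainGraph α β Γ) (X : Set β) (x : α) : Prop := ∃ g ≠ 1, Ω.Joins X x x g

namespace UnbalancedAt

lemma of_reach (h : Ω.UnbalancedAt X x) (hxy : Ω.Reach X x y) : Ω.UnbalancedAt X y := by
  obtain ⟨g, hg, h⟩ := h
  obtain ⟨k, hk⟩ := hxy
  exact ⟨k⁻¹ * g * k, by simpa [mul_assoc, inv_mul_eq_one, eq_comm] using hg,
    (hk.symm.trans h).trans hk⟩

lemma mono (h : Ω.UnbalancedAt X x) (hXY : X ⊆ Y) : Ω.UnbalancedAt Y x :=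
  ⟨_, h.choose_spec.1, h.choose_spec.2.mono hXY⟩

lemma of_ne (h₁ : Ω.Joins X x y g) (h₂ : Ω.Joins X x y h) (hgh : g ≠ h) : Ω.UnbalancedAt X x :=
  ⟨g * h⁻¹, by rwa [Ne, mul_inv_eq_one], h₁.trans h₂.symm⟩

end UnbalancedAt

/-- An edge from `x` to `y` with gain `g` would be in the closure of `X`. -/
def Determines (Ω : GainGraph α β Γ) (X : Set β) (x y : α) (g : Γ) : Prop :=
  Ω.Joins X x y g ∨ (Ω.UnbalancedAt X x ∧ Ω.UnbalancedAt X y)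

namespace Determines

lemma trans (h₁ : Ω.Determines X x y g) (h₂ : Ω.Determines X y z h) :
    Ω.Determines X x z (g * h) := by
  rcases h₁ with h₁ | h₁ <;> rcases h₂ with h₂ | h₂
  · exact .inl (h₁.trans h₂)
  · exact .inr ⟨h₂.1.of_reach ⟨_, h₁.symm⟩, h₂.2⟩
  · exact .inr ⟨h₁.1, h₁.2.of_reach ⟨_, h₂⟩⟩
  · exact .inr ⟨h₁.1, h₂.2⟩

lemma symm (h₁ : Ω.Determines X x y g) : Ω.Determines X y x g⁻¹ :=
  h₁.imp Joins.symm And.symm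

lemma mono (h₁ : Ω.Determines X x y g) (hXY : X ⊆ Y) : Ω.Determines Y x y g :=
  h₁.imp (·.mono hXY) (·.imp (·.mono hXY) (·.mono hXY))

lemma unbalancedAt (h₁ : Ω.Determines X x x g) (hg : g ≠ 1) : Ω.UnbalancedAt X x :=
  h₁.elim (fun h ↦ ⟨g, hg, h⟩) And.left

lemma swap (hl : Ω.graph.IsLink e x y) (h₁ : Ω.Determines X x y (Ω.gain e x y)) :
    Ω.Determines X y x (Ω.gain e y x) := by
  by_cases hxy : x = y
  · subst hxy
    exact h₁
  · rw [Ω.gain_symm hl.symm (Ne.symm hxy)]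
    exact h₁.symm

end Determines

/-- The closure of `X` in the frame matroid. -/
def closure (Ω : GainGraph α β Γ) (X : Set β) : Set β :=
  {e | ∃ x y, Ω.graph.IsLink e x y ∧ Ω.Determines X x y (Ω.gain e x y)}

lemma mem_closure_iff (hl : Ω.graph.IsLink e x y) :
    e ∈ Ω.closure X ↔ Ω.Determines X x y (Ω.gain e x y) := by
  refine ⟨?_, fun h ↦ ⟨x, y, hl, h⟩⟩
  rintro ⟨x', y', hl', h⟩
  obtain ⟨rfl, rfl⟩ | ⟨rfl, rfl⟩ := hl.eq_and_eq_or_eq_and_eq hl'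
  · exact h
  · exact h.swap hl'

lemma closure_mono : Monotone Ω.closure := fun _ _ hXY _ ⟨x, y, hl, h⟩ ↦ ⟨x, y, hl, h.mono hXY⟩

lemma closure_subset (X : Set β) : Ω.closure X ⊆ E(Ω.graph) := fun _ ⟨_, _, hl, _⟩ ↦ hl.edge_mem

lemma subset_closure (X : Set β) (hX : X ⊆ E(Ω.graph)) : X ⊆ Ω.closure X := by
  intro e he
  obtain ⟨x, y, hl⟩ := Ω.graph.exists_isLink_of_mem_edgeSet (hX he)
  exact ⟨x, y, hl, .inl (.single he hl)⟩

/-- If every edge of `X` is in the closure of `Y`, then whatever `X` joins is determined by `Y`. -/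
lemma Joins.determines (hj : Ω.Joins X x y g) (hX : X ⊆ Ω.closure Y) :
    Ω.Determines Y x y g := by
  induction hj with
  | refl => exact .inl .refl
  | step _ he hl ih => exact ih.trans ((mem_closure_iff hl).1 (hX he))
  | step_inv _ he hl ih => exact ih.trans ((mem_closure_iff hl).1 (hX he)).symm

/-- Unbalance at `x` or `y` is witnessed by a closed walk there, so replacing `A` by `B` only
requires treating walks between these vertices. Both idempotence of the closure and the gluing
argument use this reduction. -/
lemma Determines.of_forall_joins {A B : Set β}
    (hAB : ∀ s ∈ ({x, y} : Set α), ∀ t ∈ ({x, y} : Set α), ∀ g, Ω.Joins A s t g →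
      Ω.Determines B s t g) (hd : Ω.Determines A x y g) : Ω.Determines B x y g := by
  obtain hj | ⟨⟨k, hk, hj⟩, ⟨k', hk', hj'⟩⟩ := hd
  · exact hAB _ (by simp) _ (by simp) _ hj
  · exact .inr ⟨(hAB _ (by simp) _ (by simp) _ hj).unbalancedAt hk,
      (hAB _ (by simp) _ (by simp) _ hj').unbalancedAt hk'⟩

lemma closure_closure (X : Set β) : Ω.closure (Ω.closure X) ⊆ Ω.closure X :=
  fun _ ⟨x, y, hl, h⟩ ↦ ⟨x, y, hl, h.of_forall_joins fun _ _ _ _ _ hj ↦ hj.determines subset_rfl⟩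

/-! ### The exchange property -/

section exchange

variable {a b c d : α}

lemma Joins.of_insert (hf : Ω.graph.IsLink f c d) (hj : Ω.Joins (insert f X) x y g) :
    Ω.Joins X x y g ∨ (Ω.Reach X x c ∨ Ω.Reach X x d) ∧ (Ω.Reach X y c ∨ Ω.Reach X y d) := by
  have aux {y z : α} {g k : Γ} {e : β} (hl : Ω.graph.IsLink e y z) (he : e ∈ insert f X)
      (hk : e ∈ X → Ω.Joins X y z k)
      (ih : Ω.Joins X x y g ∨
        (Ω.Reach X x c ∨ Ω.Reach X x d) ∧ (Ω.Reach X y c ∨ Ω.Reach X y d)) :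
      Ω.Joins X x z (g * k) ∨
        (Ω.Reach X x c ∨ Ω.Reach X x d) ∧ (Ω.Reach X z c ∨ Ω.Reach X z d) := by
    obtain rfl | he := he
    · right
      obtain ⟨rfl, rfl⟩ | ⟨rfl, rfl⟩ := hl.eq_and_eq_or_eq_and_eq hf
      · refine ⟨ih.elim (fun h ↦ .inl ⟨_, h⟩) And.left, .inr .refl⟩
      · refine ⟨ih.elim (fun h ↦ .inr ⟨_, h⟩) And.left, .inl .refl⟩
    · obtain h | ⟨h₁, h₂⟩ := ih
      · exact .inl (h.trans (hk he))
      · have : Ω.Reach X z y := ⟨_, (hk he).symm⟩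
        exact .inr ⟨h₁, h₂.imp this.trans this.trans⟩
  induction hj with
  | refl => exact .inl .refl
  | step _ he hl ih => exact aux hl he (fun he ↦ .single he hl) ih
  | step_inv _ he hl ih => exact aux hl.symm he (fun he ↦ .single_inv he hl) ih

/-- Here `f` is a bridge between two balanced components of `X`. After crossing it a walk can only
cross back, and the closed walk in between has gain `1`, so the two crossings cancel and at most one
remains. -/
lemma Joins.of_insert_of_not_reach (hf : Ω.graph.IsLink f c d) (hcd : ¬ Ω.Reach X c d)
    (hc : ¬ Ω.UnbalancedAt X c) (hd : ¬ Ω.UnbalancedAt X d)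
    (hj : Ω.Joins (insert f X) x y g) :
    Ω.Joins X x y g ∨
    (∃ h k, Ω.Joins X x c h ∧ Ω.Joins X d y k ∧ g = h * Ω.gain f c d * k) ∨
    (∃ h k, Ω.Joins X x d h ∧ Ω.Joins X c y k ∧ g = h * (Ω.gain f c d)⁻¹ * k) := by
  have hne : c ≠ d := by
    rintro rfl
    exact hcd .refl
  have gain_swap : Ω.gain f d c = (Ω.gain f c d)⁻¹ := Ω.gain_symm hf.symm hne.symm
  have one_of_c {k : Γ} (hk : Ω.Joins X c c k) : k = 1 := by
    by_contra h
    exact hc ⟨k, h, hk⟩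
  have one_of_d {k : Γ} (hk : Ω.Joins X d d k) : k = 1 := by
    by_contra h
    exact hd ⟨k, h, hk⟩
  have aux {y z : α} {g k : Γ} {e : β} (hl : Ω.graph.IsLink e y z) (he : e ∈ insert f X)
      (hk : e ∈ X → Ω.Joins X y z k) (hk' : y ≠ z → k = Ω.gain e y z)
      (ih : Ω.Joins X x y g ∨
        (∃ h k, Ω.Joins X x c h ∧ Ω.Joins X d y k ∧ g = h * Ω.gain f c d * k) ∨
        (∃ h k, Ω.Joins X x d h ∧ Ω.Joins X c y k ∧ g = h * (Ω.gain f c d)⁻¹ * k)) :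
      Ω.Joins X x z (g * k) ∨
        (∃ h l, Ω.Joins X x c h ∧ Ω.Joins X d z l ∧ g * k = h * Ω.gain f c d * l) ∨
        (∃ h l, Ω.Joins X x d h ∧ Ω.Joins X c z l ∧ g * k = h * (Ω.gain f c d)⁻¹ * l) := by
    obtain rfl | he := he
    · obtain ⟨rfl, rfl⟩ | ⟨rfl, rfl⟩ := hl.eq_and_eq_or_eq_and_eq hf
      · rw [hk' hne]
        obtain h | ⟨h, l, h₁, h₂, rfl⟩ | ⟨h, l, h₁, h₂, rfl⟩ := ih
        · exact .inr (.inl ⟨g, 1, h, .refl, by simp⟩)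
        · exact (hcd ⟨_, h₂.symm⟩).elim
        · left
          rw [one_of_c h₂]
          simpa
      · rw [hk' hne.symm, gain_swap]
        obtain h | ⟨h, l, h₁, h₂, rfl⟩ | ⟨h, l, h₁, h₂, rfl⟩ := ih
        · exact .inr (.inr ⟨g, 1, h, .refl, by simp⟩)
        · left
          rw [one_of_d h₂]
          simpa
        · exact (hcd ⟨_, h₂⟩).elim
    · obtain h | ⟨h, l, h₁, h₂, rfl⟩ | ⟨h, l, h₁, h₂, rfl⟩ := ih
      · exact .inl (h.trans (hk he))
      · exact .inr (.inl ⟨h, _, h₁, h₂.trans (hk he), by simp [mul_assoc]⟩)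
      · exact .inr (.inr ⟨h, _, h₁, h₂.trans (hk he), by simp [mul_assoc]⟩)
  induction hj with
  | refl => exact .inl .refl
  | step _ he hl ih => exact aux hl he (fun he ↦ .single he hl) (fun _ ↦ rfl) ih
  | step_inv _ he hl ih =>
    exact aux hl.symm he (fun he ↦ .single_inv he hl) (fun h ↦ (Ω.gain_symm hl.symm h).symm) ih

lemma UnbalancedAt.of_insert (hf : Ω.graph.IsLink f c d) (h : Ω.UnbalancedAt (insert f X) x) :
    Ω.UnbalancedAt X x ∨ Ω.Reach X x c ∨ Ω.Reach X x d := by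
  obtain ⟨g, hg, hj⟩ := h
  exact (hj.of_insert hf).imp (fun h ↦ ⟨g, hg, h⟩) And.left

/-- This is exchange when `f` does not link two balanced components. Adding `f` can then help only
at `d`: each end of `e` is unbalanced in `X` or reaches `d`. If one end is unbalanced and the other
reaches `d`, then `e` carries the unbalance to `d`; if both reach `d`, then `e` closes an unbalanced
walk there. -/
lemma mem_closure_insert_of_unbalancedAt (hf : Ω.graph.IsLink f c d)
    (hcd : Ω.Reach X c d ∨ Ω.UnbalancedAt X c)
    (he : e ∈ Ω.closure (insert f X)) (heX : e ∉ Ω.closure X) : f ∈ Ω.closure (insert e X) := by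
  have hX : X ⊆ insert e X := Set.subset_insert _ _
  suffices h : Ω.UnbalancedAt (insert e X) d by
    refine (mem_closure_iff hf).2 (.inr ⟨?_, h⟩)
    exact hcd.elim (fun hr ↦ h.of_reach (hr.mono hX).symm) (·.mono hX)
  obtain ⟨a, b, hl, hdet⟩ := he
  have hnot : ¬ Ω.Determines X a b (Ω.gain e a b) := fun h ↦ heX ((mem_closure_iff hl).2 h)
  have hT {x : α} (h : Ω.UnbalancedAt X x ∨ Ω.Reach X x c ∨ Ω.Reach X x d) :
      Ω.UnbalancedAt X x ∨ Ω.Reach X x d := by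
    obtain h | h | h := h
    · exact .inl h
    · exact hcd.elim (fun hr ↦ .inr (h.trans hr)) fun hc ↦ .inl (hc.of_reach h.symm)
    · exact .inr h
  have hab : (Ω.UnbalancedAt X a ∨ Ω.Reach X a d) ∧ (Ω.UnbalancedAt X b ∨ Ω.Reach X b d) := by
    obtain hj | ⟨ha, hb⟩ := hdet
    · obtain h | ⟨h₁, h₂⟩ := hj.of_insert hf
      · exact (hnot (.inl h)).elim
      · exact ⟨hT (.inr h₁), hT (.inr h₂)⟩
    · exact ⟨hT (ha.of_insert hf), hT (hb.of_insert hf)⟩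
  have hr : Ω.Reach (insert e X) a b := .single (Set.mem_insert _ _) hl
  obtain ⟨ha | ha, hb | hb⟩ := hab
  · exact (hnot (.inr ⟨ha, hb⟩)).elim
  · exact ((ha.mono hX).of_reach hr).of_reach (hb.mono hX)
  · exact ((hb.mono hX).of_reach hr.symm).of_reach (ha.mono hX)
  · obtain ⟨k, hk⟩ := ha.trans hb.symm
    refine (UnbalancedAt.of_ne (hk.mono hX) (.single (Set.mem_insert _ _) hl) ?_).of_reach
      (ha.mono hX)
    rintro rfl
    exact hnot (.inl hk)

lemma closure_exchange (X : Set β) (e f : β) (hfE : f ∈ E(Ω.graph))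
    (he : e ∈ Ω.closure (insert f X)) (heX : e ∉ Ω.closure X) : f ∈ Ω.closure (insert e X) := by
  by_cases hfX : f ∈ Ω.closure X
  · exact closure_mono (Set.subset_insert _ _) hfX
  obtain ⟨c, d, hf⟩ := Ω.graph.exists_isLink_of_mem_edgeSet hfE
  have hdet := mt (mem_closure_iff hf).2 hfX
  have hX : X ⊆ insert e X := Set.subset_insert _ _
  by_cases hd : Ω.UnbalancedAt X d
  · exact mem_closure_insert_of_unbalancedAt hf.symm (.inr hd) he heX
  by_cases hcd : Ω.Reach X c d ∨ Ω.UnbalancedAt X c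
  · exact mem_closure_insert_of_unbalancedAt hf hcd he heX
  push Not at hcd
  -- A closed walk cannot cross a bridge exactly once, so `f` creates no new unbalance. Hence `e`
  -- enters the closure through a walk crossing `f` once, and that walk can be solved for the gain
  -- of `f`.
  have hunb {x : α} (h : Ω.UnbalancedAt (insert f X) x) : Ω.UnbalancedAt X x := by
    obtain ⟨g, hg, hj⟩ := h
    obtain h | ⟨h, l, h₁, h₂, rfl⟩ | ⟨h, l, h₁, h₂, rfl⟩ :=
      hj.of_insert_of_not_reach hf hcd.1 hcd.2 hd
    · exact ⟨g, hg, h⟩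
    · exact (hcd.1 ⟨_, (h₂.trans h₁).symm⟩).elim
    · exact (hcd.1 ⟨_, h₂.trans h₁⟩).elim
  obtain ⟨a, b, hl, hj | ⟨ha, hb⟩⟩ := he
  · have hab := Joins.single (Set.mem_insert e X) hl
    rw [mem_closure_iff hf]
    left
    obtain h | ⟨h, l, h₁, h₂, heq⟩ | ⟨h, l, h₁, h₂, heq⟩ :=
      hj.of_insert_of_not_reach hf hcd.1 hcd.2 hd
    · exact (heX ⟨a, b, hl, .inl h⟩).elim
    · convert ((h₁.mono hX).symm.trans hab).trans (h₂.mono hX).symm using 1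
      simp [heq, mul_assoc]
    · convert ((h₂.mono hX).trans hab.symm).trans (h₁.mono hX) using 1
      simp [heq, mul_assoc]
  · exact (heX ⟨a, b, hl, .inr ⟨hunb ha, hunb hb⟩⟩).elim

end exchange

/-- The frame matroid of a gain-graph with finitely many edges. -/
def frameMatroid (Ω : GainGraph α β Γ) (hE : E(Ω.graph).Finite) : Matroid β :=
  Matroid.ofExchangeClosure hE Ω.closure closure_mono subset_closure closure_closure
    closure_exchange

lemma frameMatroid_ground (hE : E(Ω.graph).Finite) : (Ω.frameMatroid hE).E = E(Ω.graph) := rfl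

lemma frameMatroid_indep_iff (hE : E(Ω.graph).Finite) :
    (Ω.frameMatroid hE).Indep X ↔ X ⊆ E(Ω.graph) ∧ ∀ e ∈ X, e ∉ Ω.closure (X \ {e}) := Iff.rfl

lemma frameMatroid_closure (hE : E(Ω.graph).Finite) (hX : X ⊆ E(Ω.graph)) :
    (Ω.frameMatroid hE).closure X = Ω.closure X :=
  Matroid.ofExchangeClosure_closure _ _ _ _ _ closure_subset hX

end GainGraph

/-! ### Walks, paths and cycles -/

namespace Graph.Walk

variable {α β : Type*} {G H : Graph α β} {x y z : α} {e : β}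

lemma left_mem (w : G.Walk x y) : x ∈ V(G) := by
  cases w with
  | nil hx => exact hx
  | cons e h w => exact h.left_mem

lemma left_mem_vertices (w : G.Walk x y) : x ∈ w.vertices := by
  cases w <;> simp [vertices]

lemma right_mem_vertices (w : G.Walk x y) : y ∈ w.vertices := by
  induction w with
  | nil => simp [vertices]
  | cons e h w ih => simp [vertices, ih]

lemma edges_subset (w : G.Walk x y) (he : e ∈ w.edges) : e ∈ E(G) := by
  induction w with
  | nil => simp [edges] at he
  | cons f h w ih =>
    obtain rfl | he := List.mem_cons.1 he
    · exact h.edge_mem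
    · exact ih he

lemma mem_vertices_of_isLink (w : G.Walk x y) (he : e ∈ w.edges) {a b : α}
    (hl : G.IsLink e a b) : a ∈ w.vertices := by
  induction w with
  | nil => simp [edges] at he
  | cons f h w ih =>
    obtain rfl | he := List.mem_cons.1 he
    · obtain rfl | rfl := hl.left_eq_or_eq h
      · simp [vertices]
      · simp [vertices, left_mem_vertices]
    · simp [vertices, ih he]

lemma IsPath.edges_nodup {w : G.Walk x y} (hw : w.IsPath) : w.edges.Nodup := by
  induction w with
  | nil => simp [edges]
  | cons e h w ih =>
    obtain ⟨hx, hw⟩ := List.nodup_cons.1 hw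
    exact List.nodup_cons.2 ⟨fun he ↦ hx (w.mem_vertices_of_isLink he h), ih hw⟩

lemma isCycle_cons {h : G.IsLink e x y} {w : G.Walk y x} (hw : w.IsPath) (he : e ∉ w.edges) :
    (cons e h w).IsCycle where
  edges_ne_nil := by simp [edges]
  edges_nodup := List.nodup_cons.2 ⟨he, hw.edges_nodup⟩
  vertices_tail_nodup := hw

/-- A walk all of whose edges are edges of `H` with the same ends is a walk in `H`. -/
lemma exists_transfer (w : G.Walk x y) (hx : x ∈ V(H))
    (h : ∀ e ∈ w.edges, ∀ a b, G.IsLink e a b → H.IsLink e a b) :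
    ∃ w' : H.Walk x y, w'.edges = w.edges ∧ w'.vertices = w.vertices := by
  induction w with
  | nil => exact ⟨.nil hx, rfl, rfl⟩
  | cons e hl w ih =>
    have hl' := h e (by simp [edges]) _ _ hl
    obtain ⟨w', h₁, h₂⟩ := ih hl'.right_mem fun f hf ↦ h f (by simp [edges, hf])
    exact ⟨.cons e hl' w', by simp [edges, h₁], by simp [vertices, h₂]⟩

end Graph.Walk

namespace Graph

variable {α β : Type*} {G : Graph α β} {X C : Set β}

lemma IsCycleSet.of_edgeInduced (h : (G.edgeInduced X).IsCycleSet C) :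
    G.IsCycleSet C ∧ C ⊆ X := by
  obtain ⟨x, w, hw, rfl⟩ := h
  obtain ⟨e, -, hx⟩ := w.left_mem
  obtain ⟨w', h₁, h₂⟩ := w.exists_transfer hx.vertex_mem fun e he a b hl ↦ hl.2
  refine ⟨⟨x, w', ⟨h₁ ▸ hw.1, h₁ ▸ hw.2, h₂ ▸ hw.3⟩, by rw [h₁]⟩, fun e he ↦ ?_⟩
  exact (w.edges_subset he).2

lemma IsCycleSet.edgeInduced (h : G.IsCycleSet C) (hC : C ⊆ X) :
    (G.edgeInduced X).IsCycleSet C := by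
  obtain ⟨x, w, hw, rfl⟩ := h
  have hx : x ∈ V(G.edgeInduced X) := by
    cases w with
    | nil => exact (hw.edges_ne_nil rfl).elim
    | cons e h w => exact ⟨e, hC (by simp [Walk.edges]), h.inc_left⟩
  obtain ⟨w', h₁, h₂⟩ := w.exists_transfer hx fun e he a b hl ↦ ⟨hC he, hl⟩
  exact ⟨x, w', ⟨h₁ ▸ hw.1, h₁ ▸ hw.2, h₂ ▸ hw.3⟩, by rw [h₁]⟩

end Graph

/-! ### The circuits of the frame matroid -/

namespace GainGraph

open Graph

variable {α β Γ : Type*} [Group Γ] {Ω : GainGraph α β Γ} {X Y C D : Set β} {x y z : α} {g h : Γ}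
  {e f : β}

lemma joins_walkGain (w : Ω.graph.Walk x y) (hw : ∀ e ∈ w.edges, e ∈ X) :
    Ω.Joins X x y (Ω.walkGain w) := by
  induction w with
  | nil => exact .refl
  | cons e h w ih =>
    refine (Joins.single (hw e (by simp [Walk.edges])) h).trans (ih fun f hf ↦ hw f ?_)
    simp [Walk.edges, hf]

lemma reach_of_walk (w : Ω.graph.Walk x y) (hw : ∀ e ∈ w.edges, e ∈ X) : Ω.Reach X x y :=
  ⟨_, joins_walkGain w hw⟩

lemma exists_split (w : Ω.graph.Walk x y) (hz : z ∈ w.vertices) :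
    ∃ (p : Ω.graph.Walk x z) (q : Ω.graph.Walk z y), (w.IsPath → p.IsPath ∧ q.IsPath) ∧
      p.edges ⊆ w.edges ∧ q.edges ⊆ w.edges ∧ p.vertices ⊆ w.vertices ∧
      Ω.walkGain w = Ω.walkGain p * Ω.walkGain q := by
  induction w with
  | nil hx =>
    obtain rfl : z = _ := by simpa [Walk.vertices] using hz
    exact ⟨.nil hx, .nil hx, by simp, by simp, by simp, by simp, by simp [walkGain]⟩
  | @cons x y y' e hl w ih =>
    by_cases hzx : z = x
    · subst hzx
      refine ⟨.nil hl.left_mem, .cons e hl w, fun h ↦ ⟨by simp [Walk.IsPath, Walk.vertices], h⟩,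
        by simp [Walk.edges], by simp, by simp [Walk.vertices], by simp [walkGain]⟩
    · obtain ⟨p, q, h₁, h₂, h₃, h₄, h₅⟩ := ih ((List.mem_cons.1 hz).resolve_left hzx)
      refine ⟨.cons e hl p, q, fun h ↦ ?_, ?_, ?_, ?_, ?_⟩
      · obtain ⟨hx, hw⟩ := List.nodup_cons.1 h
        exact ⟨List.nodup_cons.2 ⟨fun h ↦ hx (h₄ h), (h₁ hw).1⟩, (h₁ hw).2⟩
      · exact List.cons_subset_cons _ h₂
      · exact List.subset_cons_of_subset _ h₃
      · exact List.cons_subset_cons _ h₄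
      · simp [walkGain, h₅, mul_assoc]

/-- `C` is a cycle in the component of `x` in `X`. -/
def CycleAt (Ω : GainGraph α β Γ) (X : Set β) (x : α) (C : Set β) : Prop :=
  C ⊆ X ∧ ∃ (y : α) (w : Ω.graph.Walk y y), w.IsCycle ∧ C = {e | e ∈ w.edges} ∧ Ω.Reach X x y

lemma CycleAt.isCycleSet (h : Ω.CycleAt X x C) : Ω.graph.IsCycleSet C := by
  obtain ⟨-, y, w, hw, rfl, -⟩ := h
  exact ⟨y, w, hw, rfl⟩

lemma CycleAt.mono (h : Ω.CycleAt X x C) (hXY : X ⊆ Y) : Ω.CycleAt Y x C := by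
  obtain ⟨hC, y, w, hw, rfl, hr⟩ := h
  exact ⟨hC.trans hXY, y, w, hw, rfl, hr.mono hXY⟩

lemma CycleAt.of_reach (h : Ω.CycleAt X x C) (hr : Ω.Reach X y x) : Ω.CycleAt X y C := by
  obtain ⟨hC, z, w, hw, rfl, hr'⟩ := h
  exact ⟨hC, z, w, hw, rfl, hr.trans hr'⟩

/-- Unless a cycle appears, only backtracks have to be cancelled, which preserves the gain. `Joins`
grows at its end and `Walk` at its start, so the path is built backwards and has gain `g⁻¹`. -/
lemma Joins.exists_isPath_or_cycleAt (hj : Ω.Joins X x y g) (hx : x ∈ V(Ω.graph)) :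
    (∃ w : Ω.graph.Walk y x, w.IsPath ∧ (∀ e ∈ w.edges, e ∈ X) ∧ Ω.walkGain w = g⁻¹) ∨
      ∃ C, Ω.CycleAt X x C := by
  have aux {y z : α} {g k : Γ} {e : β} (hj : Ω.Joins X x y g) (he : e ∈ X)
      (hl : Ω.graph.IsLink e z y)
      (hk : z ≠ y → k = (Ω.gain e z y)⁻¹)
      (ih : (∃ w : Ω.graph.Walk y x, w.IsPath ∧ (∀ e ∈ w.edges, e ∈ X) ∧ Ω.walkGain w = g⁻¹) ∨
        ∃ C, Ω.CycleAt X x C) :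
      (∃ w : Ω.graph.Walk z x, w.IsPath ∧ (∀ e ∈ w.edges, e ∈ X) ∧
        Ω.walkGain w = (g * k)⁻¹) ∨ ∃ C, Ω.CycleAt X x C := by
    refine ih.elim ?_ .inr
    rintro ⟨w, hw, hwX, hg⟩
    have hr : Ω.Reach X x z := Reach.trans ⟨_, hj⟩ (.single he hl.symm)
    by_cases hzy : z = y
    · subst hzy
      refine .inr ⟨{e}, by simpa, z, .cons e hl (.nil hl.left_mem), ⟨?_, ?_, ?_⟩, ?_, hr⟩ <;>
        simp [Walk.edges, Walk.vertices]
    by_cases hz : z ∈ w.vertices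
    · obtain ⟨p, q, hpq, hp, hq, -, hgain⟩ := exists_split w hz
      obtain ⟨hpp, hqp⟩ := hpq hw
      -- The path `p` leads from `y` to `z`, the ends of `e`. If it uses `e`, it consists of `e`
      -- alone and is a backtrack; otherwise it closes a cycle with `e`.
      by_cases hep : e ∈ p.edges
      · left
        refine ⟨q, hqp, fun f hf ↦ hwX f (hq hf), ?_⟩
        suffices hpg : Ω.walkGain p = k by
          rw [mul_inv_rev, ← hg, hgain, hpg, inv_mul_cancel_left]
        cases p with
        | nil => simp [Walk.edges] at hep
        | cons f hf p =>
          obtain ⟨hyp, hp'⟩ := List.nodup_cons.1 hpp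
          obtain rfl | hep := List.mem_cons.1 hep
          · obtain rfl := hf.right_unique hl.symm
            have hone : Ω.walkGain p = 1 := by
              cases p with
              | nil => rfl
              | cons f hf p => exact absurd p.right_mem_vertices (List.nodup_cons.1 hp').1
            rw [hk hzy, walkGain, hone, mul_one]
            exact Ω.gain_symm hl.symm (Ne.symm hzy)
          · exact absurd (p.mem_vertices_of_isLink hep hl.symm) hyp
      · refine .inr ⟨{f | f ∈ (Walk.cons e hl p).edges}, ?_, z, .cons e hl p,
          Walk.isCycle_cons hpp hep, rfl, hr⟩
        rintro f hf
        obtain rfl | hf := List.mem_cons.1 hf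
        · exact he
        · exact hwX f (hp hf)
    · refine .inl ⟨.cons e hl w, List.nodup_cons.2 ⟨hz, hw⟩, ?_, ?_⟩
      · intro f hf
        obtain rfl | hf := List.mem_cons.1 hf
        · exact he
        · exact hwX f hf
      · rw [hk hzy, walkGain, hg]
        simp
  induction hj with
  | refl => exact .inl ⟨.nil hx, by simp [Walk.IsPath, Walk.vertices], by simp [Walk.edges],
      by simp [walkGain]⟩
  | step hj he hl ih =>
    exact aux hj he hl.symm (fun h ↦ Ω.gain_symm hl (Ne.symm h)) ih
  | step_inv hj he hl ih => exact aux hj he hl (fun _ ↦ rfl) ih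

lemma UnbalancedAt.exists_cycleAt (h : Ω.UnbalancedAt X x) (hx : x ∈ V(Ω.graph)) :
    ∃ C, Ω.CycleAt X x C := by
  obtain ⟨g, hg, hj⟩ := h
  obtain ⟨w, hw, -, hwg⟩ | h := hj.exists_isPath_or_cycleAt hx
  · cases w with
    | nil => exact (hg (by simpa [walkGain, eq_comm] using hwg)).elim
    | cons f hf p => exact absurd p.right_mem_vertices (List.nodup_cons.1 hw).1
  · exact h

lemma Reach.exists_isPath (hr : Ω.Reach X x y) (hx : x ∈ V(Ω.graph)) :
    ∃ w : Ω.graph.Walk x y, w.IsPath ∧ ∀ e ∈ w.edges, e ∈ X := by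
  obtain ⟨g, hj⟩ := hr.symm
  clear hr
  have aux {x z : α} {e : β} (he : e ∈ X) (hl : Ω.graph.IsLink e z x)
      (ih : ∃ w : Ω.graph.Walk x y, w.IsPath ∧ ∀ e ∈ w.edges, e ∈ X) :
      ∃ w : Ω.graph.Walk z y, w.IsPath ∧ ∀ e ∈ w.edges, e ∈ X := by
    obtain ⟨w, hw, hwX⟩ := ih
    by_cases hz : z ∈ w.vertices
    · obtain ⟨p, q, hpq, -, hq, -, -⟩ := exists_split w hz
      exact ⟨q, (hpq hw).2, fun f hf ↦ hwX f (hq hf)⟩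
    · refine ⟨.cons e hl w, List.nodup_cons.2 ⟨hz, hw⟩, fun f hf ↦ ?_⟩
      obtain rfl | hf := List.mem_cons.1 hf
      · exact he
      · exact hwX f hf
  induction hj with
  | refl => exact ⟨.nil hx, by simp [Walk.IsPath, Walk.vertices], by simp [Walk.edges]⟩
  | step _ he hl ih => exact aux he hl.symm (ih hl.left_mem)
  | step_inv _ he hl ih => exact aux he hl (ih hl.right_mem)

/-- The ends of an edge of a trail are joined to the ends of the trail by the other edges. -/
lemma exists_reach_sdiff_of_mem_edges (w : Ω.graph.Walk x y) (hw : w.edges.Nodup)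
    (he : e ∈ w.edges) : ∃ a b, Ω.graph.IsLink e a b ∧
      Ω.Reach ({f | f ∈ w.edges} \ {e}) x a ∧ Ω.Reach ({f | f ∈ w.edges} \ {e}) b y := by
  induction w with
  | nil => simp [Walk.edges] at he
  | cons f hl w ih =>
    obtain ⟨hf, hw⟩ := List.nodup_cons.1 hw
    obtain rfl | he := List.mem_cons.1 he
    · refine ⟨_, _, hl, .refl, reach_of_walk w fun f' hf' ↦ ?_⟩
      refine ⟨by simp [Walk.edges, hf'], ?_⟩
      rintro rfl
      exact hf hf'
    · obtain ⟨a, b, hab, h₁, h₂⟩ := ih hw he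
      have hss : {f | f ∈ w.edges} \ {e} ⊆ {f' | f' ∈ (Walk.cons f hl w).edges} \ {e} :=
        Set.sdiff_subset_sdiff_left fun f' hf' ↦ by simp_all [Walk.edges]
      refine ⟨a, b, hab, .trans (.single ⟨by simp [Walk.edges], ?_⟩ hl) (h₁.mono hss),
        h₂.mono hss⟩
      rintro rfl
      exact hf he

lemma reach_sdiff_of_isCycleSet (hC : Ω.graph.IsCycleSet C) (he : e ∈ C)
    (hl : Ω.graph.IsLink e x y) : Ω.Reach (C \ {e}) x y := by
  obtain ⟨z, w, hw, rfl⟩ := hC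
  obtain ⟨a, b, hab, h₁, h₂⟩ := exists_reach_sdiff_of_mem_edges w hw.edges_nodup he
  obtain ⟨rfl, rfl⟩ | ⟨rfl, rfl⟩ := hl.eq_and_eq_or_eq_and_eq hab
  · exact (h₂.trans h₁).symm
  · exact h₂.trans h₁

/-- Induction on the path. Its first vertex meets only the first edge, so that edge is a bridge, and
a detour around a later edge cannot profit from it. -/
lemma not_reach_sdiff_of_isPath (w : Ω.graph.Walk x y) (hw : w.IsPath) (he : e ∈ w.edges)
    {a b : α} (hl : Ω.graph.IsLink e a b) : ¬ Ω.Reach ({f | f ∈ w.edges} \ {e}) a b := by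
  induction w generalizing e a b with
  | nil => simp [Walk.edges] at he
  | @cons x y z f hf w ih =>
    obtain ⟨hx, hw⟩ := List.nodup_cons.1 hw
    intro hr
    -- reachability from the first vertex of the path without its first edge
    have hfirst {S : Set β} (hS : S ⊆ {f' | f' ∈ w.edges}) {b : α} (h : Ω.Reach S x b) :
        b = x := by
      obtain ⟨g, hj⟩ := h
      induction hj with
      | refl => rfl
      | step _ he hl ih =>
        exact absurd (w.mem_vertices_of_isLink (hS he) (ih ▸ hl)) hx
      | step_inv _ he hl ih =>
        exact absurd (w.mem_vertices_of_isLink (hS he) (ih ▸ hl.symm)) hx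
    have hyx : y ≠ x := by
      rintro rfl
      exact hx w.left_mem_vertices
    obtain rfl | hew := List.mem_cons.1 he
    · have hS : {f | f ∈ (Walk.cons e hf w).edges} \ {e} ⊆ {f' | f' ∈ w.edges} := by
        rintro f' ⟨h₁, h₂⟩
        exact (List.mem_cons.1 h₁).resolve_left h₂
      obtain ⟨rfl, rfl⟩ | ⟨rfl, rfl⟩ := hl.eq_and_eq_or_eq_and_eq hf
      · exact hyx (hfirst hS hr)
      · exact hyx (hfirst hS hr.symm)
    · set S := {f' | f' ∈ w.edges} \ {e}
      have hS : {f' | f' ∈ (Walk.cons f hf w).edges} \ {e} ⊆ insert f S := by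
        rintro f' ⟨h₁, h₂⟩
        exact (List.mem_cons.1 h₁).imp id fun h ↦ ⟨h, h₂⟩
      have hSw : S ⊆ {f' | f' ∈ w.edges} := Set.sdiff_subset
      have hav : a ≠ x := by
        rintro rfl
        exact hx (w.mem_vertices_of_isLink hew hl)
      have hbv : b ≠ x := by
        rintro rfl
        exact hx (w.mem_vertices_of_isLink hew hl.symm)
      obtain ⟨g, hj⟩ := hr.mono hS
      obtain h | ⟨h₁, h₂⟩ := hj.of_insert hf
      · exact ih hw hew hl ⟨_, h⟩
      · have h₁ := h₁.resolve_left fun h ↦ hav (hfirst hSw h.symm)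
        have h₂ := h₂.resolve_left fun h ↦ hbv (hfirst hSw h.symm)
        exact ih hw hew hl (h₁.trans h₂.symm)

/-- Deleting an edge `e` from `C` leaves a path, all of whose edges are bridges. A smaller cycle `D`
would bypass one of them: an edge of `D` if `e ∉ D`, and an edge of `C` outside `D` if `e ∈ D`. -/
lemma eq_of_isCycleSet_subset (hC : Ω.graph.IsCycleSet C) (hD : Ω.graph.IsCycleSet D)
    (hDC : D ⊆ C) : D = C := by
  refine hDC.antisymm fun f hfC ↦ ?_
  by_contra hfD
  obtain ⟨z, w, hw, rfl⟩ := hC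
  cases w with
  | nil => exact hw.edges_ne_nil rfl
  | @cons x y z e hl p =>
    have hp : p.IsPath := hw.vertices_tail_nodup
    have key {d : β} (hd : d ∈ D) (hdp : d ∈ p.edges) (hDp : D \ {d} ⊆ {f | f ∈ p.edges} \ {d}) :
        False := by
      obtain ⟨a, b, hab⟩ := Ω.graph.exists_isLink_of_mem_edgeSet (p.edges_subset hdp)
      exact not_reach_sdiff_of_isPath p hp hdp hab
        ((reach_sdiff_of_isCycleSet hD hd hab).mono hDp)
    by_cases heD : e ∈ D
    · have hfp : f ∈ p.edges := (List.mem_cons.1 hfC).resolve_left fun h ↦ hfD (h ▸ heD)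
      obtain ⟨a, b, hab, h₁, h₂⟩ := exists_reach_sdiff_of_mem_edges p hp.edges_nodup hfp
      refine not_reach_sdiff_of_isPath p hp hfp hab (h₁.symm.trans (.trans ?_ h₂.symm))
      refine (reach_sdiff_of_isCycleSet hD heD hl).symm.mono fun d hd ↦ ⟨?_, ?_⟩
      · exact (List.mem_cons.1 (hDC hd.1)).resolve_left hd.2
      · rintro rfl
        exact hfD hd.1
    · have hDp : D ⊆ {f | f ∈ p.edges} := fun d hd ↦ (List.mem_cons.1 (hDC hd)).resolve_left
        fun h ↦ heD (h ▸ hd)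
      obtain ⟨z, w, hw', rfl⟩ := hD
      obtain ⟨d, hd⟩ := List.exists_mem_of_ne_nil _ hw'.edges_ne_nil
      exact key hd (hDp hd) (Set.sdiff_subset_sdiff_left hDp)

lemma IsBalancedCycle.isCycleSet (hC : Ω.IsBalancedCycle C) : Ω.graph.IsCycleSet C := by
  obtain ⟨x, w, hw, -, rfl⟩ := hC
  exact ⟨x, w, hw, rfl⟩

lemma IsBalancedCycle.exists_mem_closure (hC : Ω.IsBalancedCycle C) :
    ∃ e ∈ C, e ∈ Ω.closure (C \ {e}) := by
  obtain ⟨x, w, hw, hg, rfl⟩ := hC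
  cases w with
  | nil => exact (hw.edges_ne_nil rfl).elim
  | cons e hl w =>
    refine ⟨e, by simp [Walk.edges], _, _, hl, .inl ?_⟩
    rw [eq_inv_of_mul_eq_one_left (show Ω.gain e _ _ * Ω.walkGain w = 1 from hg)]
    refine Joins.symm (joins_walkGain w fun f hf ↦ ⟨List.mem_cons_of_mem _ hf, ?_⟩)
    rintro rfl
    exact (List.nodup_cons.1 hw.edges_nodup).1 hf

/-- If `D` is unbalanced, take `e` in `C` but not in `D`. Removing `e` keeps `Y` connected since `e`
lies on `C`, and keeps it unbalanced since `D` survives, so `e` is spanned by the rest. -/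
lemma exists_mem_closure_of_two_cycles (hY : (Ω.graph.edgeInduced Y).IsConnected)
    (hC : (Ω.graph.edgeInduced Y).IsCycleSet C) (hD : (Ω.graph.edgeInduced Y).IsCycleSet D)
    (hCD : C ≠ D) : ∃ e ∈ Y, e ∈ Ω.closure (Y \ {e}) := by
  obtain ⟨hC, hCY⟩ := hC.of_edgeInduced
  obtain ⟨hD, hDY⟩ := hD.of_edgeInduced
  obtain ⟨e, heC, heD⟩ := Set.not_subset.1 fun h ↦ hCD (eq_of_isCycleSet_subset hD hC h)
  by_cases hDb : Ω.IsBalancedCycle D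
  · obtain ⟨f, hfD, hf⟩ := hDb.exists_mem_closure
    exact ⟨f, hDY hfD, closure_mono (Set.sdiff_subset_sdiff_left hDY) hf⟩
  have heE : e ∈ E(Ω.graph) := by
    obtain ⟨x, w, hw, rfl⟩ := hC
    exact w.edges_subset heC
  obtain ⟨a, b, hab⟩ := Ω.graph.exists_isLink_of_mem_edgeSet heE
  have hab' : Ω.Reach (Y \ {e}) a b :=
    (reach_sdiff_of_isCycleSet hC heC hab).mono (Set.sdiff_subset_sdiff_left hCY)
  have hDe : D ⊆ Y \ {e} := Set.subset_sdiff_singleton hDY heD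
  obtain ⟨z, w, hw, rfl⟩ := hD
  have hz : Ω.UnbalancedAt (Y \ {e}) z :=
    ⟨Ω.walkGain w, fun h ↦ hDb ⟨z, w, hw, h, rfl⟩, joins_walkGain w fun f hf ↦ hDe hf⟩
  have hzY : z ∈ V(Ω.graph.edgeInduced Y) := by
    cases w with
    | nil => exact (hw.edges_ne_nil rfl).elim
    | cons f h w => exact ⟨f, hDY (by simp [Walk.edges]), h.inc_left⟩
  have hza : Ω.Reach Y z a := by
    obtain ⟨w⟩ := hY.2 z hzY a ⟨e, hCY heC, hab.inc_left⟩
    obtain ⟨f, -, hfz⟩ := hzY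
    obtain ⟨w', hw', -⟩ := w.exists_transfer (H := Ω.graph) hfz.vertex_mem fun e he a b hl ↦ hl.2
    exact reach_of_walk w' fun f hf ↦ (w.edges_subset (hw' ▸ hf)).2
  have hza' : Ω.Reach (Y \ {e}) z a := by
    obtain ⟨g, hj⟩ := hza
    have hins : Y ⊆ insert e (Y \ {e}) := by simp
    obtain h | ⟨h, -⟩ := (hj.mono hins).of_insert hab
    · exact ⟨_, h⟩
    · exact h.elim id fun h ↦ h.trans hab'.symm
  have ha := hz.of_reach hza'
  exact ⟨e, hCY heC, a, b, hab, .inr ⟨ha, ha.of_reach hab'⟩⟩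

/-- The component of two different cycles contains a bicycle. -/
lemma CycleAt.exists_isBicycle (hfin : X.Finite) (hX : X ⊆ E(Ω.graph))
    (hC : Ω.CycleAt X x C) (hD : Ω.CycleAt X x D) (hCD : C ≠ D) :
    ∃ Y ⊆ X, Ω.graph.IsBicycle Y := by
  set Y := {e ∈ X | ∃ y, Ω.graph.Inc e y ∧ Ω.Reach X x y} with hYdef
  have hYX : Y ⊆ X := fun e he ↦ he.1
  have hreach {y : α} (h : Ω.Reach X x y) : Ω.Reach Y x y := by
    obtain ⟨g, hj⟩ := h
    induction hj with
    | refl => exact .refl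
    | step hj he hl ih => exact ih.trans (.single ⟨he, _, hl.inc_left, _, hj⟩ hl)
    | step_inv hj he hl ih => exact ih.trans (.single ⟨he, _, hl.inc_right, _, hj⟩ hl.symm)
  have hcycle {C : Set β} (hC : Ω.CycleAt X x C) : (Ω.graph.edgeInduced Y).IsCycleSet C := by
    refine hC.isCycleSet.edgeInduced fun e he ↦ ?_
    obtain ⟨hCX, y, w, hw, rfl, hr⟩ := hC
    obtain ⟨a, b, hab, h₁, -⟩ := exists_reach_sdiff_of_mem_edges w hw.edges_nodup he
    exact ⟨hCX he, a, hab.inc_left, hr.trans (h₁.mono (Set.sdiff_subset.trans hCX))⟩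
  have hvert {y : α} (hy : y ∈ V(Ω.graph.edgeInduced Y)) : Ω.Reach Y x y := by
    obtain ⟨e, ⟨heX, z, hez, hr⟩, z', hey⟩ := hy
    obtain rfl | rfl := hez.eq_or_eq_of_isLink hey
    · exact hreach hr
    · exact hreach (hr.trans (.single heX hey.symm))
  have hconn : (Ω.graph.edgeInduced Y).IsConnected := by
    constructor
    · obtain ⟨y, w, hw, -⟩ := hcycle hC
      exact ⟨y, w.left_mem⟩
    · intro y hy z hz
      obtain ⟨e, -, hey⟩ := id hy
      obtain ⟨w, -, hw⟩ := ((hvert hy).symm.trans (hvert hz)).exists_isPath hey.vertex_mem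
      obtain ⟨w', -⟩ := w.exists_transfer hy fun e he a b hl ↦ ⟨hw e he, hl⟩
      exact ⟨w'⟩
  have hfin' : {Z | Z ⊆ Y ∧ (Z ⊆ E(Ω.graph) ∧ (Ω.graph.edgeInduced Z).IsConnected ∧
      ∃ C₁ C₂ : Set β, C₁ ≠ C₂ ∧ (Ω.graph.edgeInduced Z).IsCycleSet C₁ ∧
        (Ω.graph.edgeInduced Z).IsCycleSet C₂)}.Finite :=
    (hfin.subset hYX).finite_subsets.subset fun _ h ↦ h.1
  obtain ⟨Z, hZY, hZ⟩ := hfin'.exists_le_minimal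
    ⟨subset_rfl, hYX.trans hX, hconn, C, D, hCD, hcycle hC, hcycle hD⟩
  exact ⟨Z, hZY.trans hYX, hZ.prop.2,
    fun W hW hWZ ↦ hZ.le_of_le ⟨le_trans hWZ hZY, hW⟩ hWZ⟩

/-- If the ends of `e` are joined with the right gain, either the walk reduces to a path that closes
a balanced cycle with `e`, or there is a cycle avoiding `e` next to one through `e`. If both ends
are unbalanced, each has a cycle in its component. -/
lemma exists_balanced_or_isBicycle (hfin : X.Finite) (hX : X ⊆ E(Ω.graph)) (he : e ∈ X)
    (hecl : e ∈ Ω.closure (X \ {e})) :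
    ∃ Y ⊆ X, Ω.IsBalancedCycle Y ∨ Ω.graph.IsBicycle Y := by
  have hss : X \ {e} ⊆ X := Set.sdiff_subset
  obtain ⟨a, b, hab, hdet⟩ := hecl
  have key {C : Set β} (hC : Ω.CycleAt (X \ {e}) a C) (hr : Ω.Reach (X \ {e}) a b) :
      ∃ Y ⊆ X, Ω.graph.IsBicycle Y := by
    obtain ⟨w, hw, hwX⟩ := hr.symm.exists_isPath hab.right_mem
    have hew : e ∉ w.edges := fun h ↦ (hwX e h).2 rfl
    refine (hC.mono hss).exists_isBicycle hfin hX
      (D := {f | f ∈ (Walk.cons e hab w).edges}) ⟨fun f hf ↦ ?_, _, Walk.cons e hab w,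
        Walk.isCycle_cons hw hew, rfl, .refl⟩ ?_
    · obtain rfl | hf := List.mem_cons.1 hf
      · exact he
      · exact (hwX f hf).1
    · rintro rfl
      exact (hC.1 (show e ∈ (Walk.cons e hab w).edges by simp [Walk.edges])).2 rfl
  obtain hj | ⟨ha, hb⟩ := hdet
  · obtain ⟨w, hw, hwX, hg⟩ | ⟨C, hC⟩ := hj.exists_isPath_or_cycleAt hab.left_mem
    · have hew : e ∉ w.edges := fun h ↦ (hwX e h).2 rfl
      refine ⟨{f | f ∈ (Walk.cons e hab w).edges}, fun f hf ↦ ?_, .inl ⟨_, Walk.cons e hab w,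
        Walk.isCycle_cons hw hew, ?_, rfl⟩⟩
      · obtain rfl | hf := List.mem_cons.1 hf
        · exact he
        · exact (hwX f hf).1
      · rw [walkGain, hg, mul_inv_cancel]
    · obtain ⟨Y, hYX, hY⟩ := key hC ⟨_, hj⟩
      exact ⟨Y, hYX, .inr hY⟩
  · obtain ⟨C, hC⟩ := ha.exists_cycleAt hab.left_mem
    obtain ⟨D, hD⟩ := hb.exists_cycleAt hab.right_mem
    suffices h : ∃ Y ⊆ X, Ω.graph.IsBicycle Y by
      obtain ⟨Y, hYX, hY⟩ := h
      exact ⟨Y, hYX, .inr hY⟩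
    -- A cycle shared by both ends shows that they are connected without `e`, so a second cycle runs
    -- through `e`.
    by_cases hCD : C = D
    · subst hCD
      refine key hC ?_
      obtain ⟨-, y, w, hw, rfl, hr⟩ := hC
      obtain ⟨hDX, y', w', hw', heq, hr'⟩ := hD
      refine hr.trans (.trans ?_ hr'.symm)
      have hne := List.exists_mem_of_ne_nil _ hw.edges_ne_nil
      obtain ⟨f, hf⟩ := hne
      have hf' : f ∈ w'.edges := heq.subset hf
      obtain ⟨c, d, hl, h₁, -⟩ := exists_reach_sdiff_of_mem_edges w hw.edges_nodup hf
      obtain ⟨c', d', hl', h₁', h₂'⟩ := exists_reach_sdiff_of_mem_edges w' hw'.edges_nodup hf'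
      replace h₁ := h₁.mono (Set.sdiff_subset.trans hDX)
      replace h₁' := h₁'.mono (Set.sdiff_subset.trans (heq.symm.subset.trans hDX))
      replace h₂' := h₂'.mono (Set.sdiff_subset.trans (heq.symm.subset.trans hDX))
      obtain ⟨rfl, rfl⟩ | ⟨rfl, rfl⟩ := hl.eq_and_eq_or_eq_and_eq hl'
      · exact h₁.trans h₁'.symm
      · exact h₁.trans h₂'
    · exact (hC.mono hss).exists_isBicycle hfin hX
        ((hD.mono hss).of_reach (.single he hab)) hCD

/-- The dependent sets are those containing a balanced cycle or a bicycle, and the circuits are the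
minimal ones. A cycle contains no other cycle, hence no bicycle, so only balanced cycles inside
bicycles have to be excluded. -/
lemma isFrameMatroid_frameMatroid (hE : E(Ω.graph).Finite) :
    Ω.IsFrameMatroid (Ω.frameMatroid hE) where
  ground_eq := rfl
  isCircuit_iff C := by
    have hdep (X : Set β) : (Ω.frameMatroid hE).Dep X ↔
        X ⊆ E(Ω.graph) ∧ ∃ e ∈ X, e ∈ Ω.closure (X \ {e}) := by
      rw [Matroid.dep_iff, frameMatroid_indep_iff, frameMatroid_ground]
      push Not
      constructor
      · rintro ⟨h, hX⟩
        exact ⟨hX, h hX⟩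
      · rintro ⟨hX, h⟩
        exact ⟨fun _ ↦ h, hX⟩
    have hcyc {C : Set β} (hC : Ω.IsBalancedCycle C) : (Ω.frameMatroid hE).Dep C := by
      refine (hdep C).2 ⟨?_, hC.exists_mem_closure⟩
      obtain ⟨x, w, -, -, rfl⟩ := hC
      exact fun e he ↦ w.edges_subset he
    have hbic {C : Set β} (hC : Ω.graph.IsBicycle C) : (Ω.frameMatroid hE).Dep C := by
      obtain ⟨hCE, hconn, C₁, C₂, hne, h₁, h₂⟩ := hC.prop
      exact (hdep C).2 ⟨hCE, exists_mem_closure_of_two_cycles hconn h₁ h₂ hne⟩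
    have hex {D : Set β} (hD : (Ω.frameMatroid hE).Dep D) :
        ∃ Y ⊆ D, Ω.IsBalancedCycle Y ∨ Ω.graph.IsBicycle Y := by
      obtain ⟨hDE, e, heD, he⟩ := (hdep D).1 hD
      exact exists_balanced_or_isBicycle (hE.subset hDE) hDE heD he
    rw [Matroid.isCircuit_iff]
    constructor
    · rintro ⟨hC, hmin⟩
      obtain ⟨Y, hYC, hY⟩ := hex hC
      obtain rfl := hmin (hY.elim hcyc hbic) hYC
      by_cases hYb : Ω.IsBalancedCycle Y
      · exact .inl hYb
      refine .inr ⟨hY.resolve_left hYb, fun D hD hDb ↦ hYb ?_⟩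
      rwa [← hmin (hcyc hDb) hD]
    · rintro (hC | ⟨hC, hCb⟩)
      · refine ⟨hcyc hC, fun D hD hDC ↦ ?_⟩
        obtain ⟨Y, hYD, hY | hY⟩ := hex hD
        · have := eq_of_isCycleSet_subset hC.isCycleSet hY.isCycleSet (hYD.trans hDC)
          exact hDC.antisymm (this ▸ hYD)
        · obtain ⟨-, -, C₁, C₂, hne, h₁, h₂⟩ := hY.prop
          obtain ⟨h₁, h₁'⟩ := h₁.of_edgeInduced
          obtain ⟨h₂, h₂'⟩ := h₂.of_edgeInduced
          have hYC := hYD.trans hDC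
          exact absurd ((eq_of_isCycleSet_subset hC.isCycleSet h₁ (h₁'.trans hYC)).trans
            (eq_of_isCycleSet_subset hC.isCycleSet h₂ (h₂'.trans hYC)).symm) hne
      · refine ⟨hbic hC, fun D hD hDC ↦ ?_⟩
        obtain ⟨Y, hYD, hY | hY⟩ := hex hD
        · exact absurd hY (hCb Y (hYD.trans hDC))
        · exact hDC.antisymm ((hC.le_of_le hY.prop (hYD.trans hDC)).trans hYD)

end GainGraph

/-! ### Modular flats and modular pairs -/

namespace Matroid

variable {β : Type*} {M : Matroid β} {X Y : Set β}

/-- Of two incomparable flats, each has rank below that of the union, hence at most one.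
Submodularity gives the other inequality. -/
lemma isModular_of_eRank_le_two (hM : M.eRank ≤ 2) : M.IsModular := by
  intro F F' hF hF'
  by_cases h : F ⊆ F'
  · rw [Set.inter_eq_self_of_subset_left h, Set.union_eq_self_of_subset_left h]
  by_cases h' : F' ⊆ F
  · rw [Set.inter_eq_self_of_subset_right h', Set.union_eq_self_of_subset_right h', add_comm]
  have key {F F' : Set β} (hF : M.IsFlat F) (hF' : M.IsFlat F') (h : ¬ F ⊆ F') :
      M.eRk F' + 1 ≤ M.eRk (F ∪ F') := by
    obtain ⟨e, heF, heF'⟩ := Set.not_subset.1 h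
    rw [← eRk_insert_eq_add_one ⟨hF.subset_ground heF, by rwa [hF'.closure]⟩]
    exact M.eRk_mono (Set.insert_subset (.inl heF) Set.subset_union_right)
  have h₁ : M.eRk F ≤ 1 := by
    have := (key hF' hF h').trans ((M.eRk_le_eRank _).trans hM)
    rw [← one_add_one_eq_two] at this
    exact (ENat.add_le_add_iff_right ENat.one_ne_top).1 this
  refine le_antisymm ?_ (M.eRk_inter_add_eRk_union_le F F')
  calc M.eRk F + M.eRk F' ≤ M.eRk F' + 1 := by
        rw [add_comm]
        gcongr
    _ ≤ M.eRk (F ∪ F') := key hF hF' h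
    _ ≤ _ := le_add_self

/-- A criterion for two sets to form a modular pair. -/
lemma eRk_add_eRk_of_closure_inter_subset (hX : X ⊆ M.E) (hY : Y ⊆ M.E)
    (h : ∀ A, X ∩ Y ⊆ A → A ⊆ X → M.closure (A ∪ Y) ∩ X ⊆ M.closure A) :
    M.eRk (X ∪ Y) + M.eRk (X ∩ Y) = M.eRk X + M.eRk Y := by
  obtain ⟨I₀, hI₀⟩ := M.exists_isBasis (X ∩ Y) (Set.inter_subset_left.trans hX)
  obtain ⟨I, hI, hI₀I⟩ :=
    hI₀.indep.subset_isBasis_of_subset (hI₀.subset.trans Set.inter_subset_left) hX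
  obtain ⟨J, hJ, hI₀J⟩ :=
    hI₀.indep.subset_isBasis_of_subset (hI₀.subset.trans Set.inter_subset_right) hY
  have hinter : I₀ = I ∩ J := hI₀.eq_of_subset_indep (hI.indep.inter_right J)
    (Set.subset_inter hI₀I hI₀J) (Set.inter_subset_inter hI.subset hJ.subset)
  have hIJ : M.Indep (I ∪ J) := by
    have hE : I ∪ J ⊆ M.E := Set.union_subset hI.indep.subset_ground hJ.indep.subset_ground
    by_contra hdep
    obtain ⟨C, hC, hcirc⟩ := ((not_indep_iff hE).1 hdep).exists_isCircuit_subset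
    by_cases hCJ : C ⊆ J
    · exact hcirc.not_indep (hJ.indep.subset hCJ)
    obtain ⟨e, heC, heJ⟩ := Set.not_subset.1 hCJ
    have heI : e ∈ I := (hC heC).resolve_right heJ
    -- The criterion is used with `A = (I \ {e}) ∪ (X ∩ Y)`. Adding `X ∩ Y` does not enlarge the
    -- closure, since its basis `I₀` lies in `I` and avoids `e`.
    have hsub : C \ {e} ⊆ ((I \ {e}) ∪ (X ∩ Y)) ∪ Y := by
      rintro f ⟨hfC, hfe⟩
      obtain hf | hf := hC hfC
      · exact .inl (.inl ⟨hf, hfe⟩)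
      · exact .inr (hJ.subset hf)
    have he₁ := M.closure_subset_closure hsub (hcirc.mem_closure_sdiff_singleton_of_mem heC)
    have he₂ := h _ Set.subset_union_right (Set.union_subset
      (Set.sdiff_subset.trans hI.subset) Set.inter_subset_left) ⟨he₁, hI.subset heI⟩
    refine hI.indep.notMem_closure_sdiff_of_mem heI ?_
    refine M.closure_subset_closure_of_subset_closure (Set.union_subset ?_ ?_) he₂
    · exact M.subset_closure _ (Set.sdiff_subset.trans hI.indep.subset_ground)
    · refine hI₀.subset_closure.trans (M.closure_subset_closure ?_)
      refine Set.subset_sdiff_singleton hI₀I fun he ↦ heJ (hI₀J he)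
  have hbasis := hI.union_isBasis_union hJ hIJ
  rw [← hbasis.encard_eq_eRk, ← hI₀.encard_eq_eRk, ← hI.encard_eq_eRk, ← hJ.encard_eq_eRk, hinter,
    Set.encard_union_add_encard_inter]

end Matroid

/-! ### Gluing along two vertices -/

namespace GainGraph

variable {α β Γ : Type*} [Group Γ] {Ω Ω' : GainGraph α β Γ} {X Y A B E₁ E₂ : Set β}
  {x y u v : α} {g h : Γ} {e : β}

/-- Replace the excursions of a walk into `B`, which start and end at `u` or `v`, using `A`. -/
lemma Joins.determines_of_union {P Q : α → Prop}
    (hA : ∀ e ∈ A, ∀ x y, Ω.graph.IsLink e x y → P x)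
    (hB : ∀ e ∈ B, ∀ x y, Ω.graph.IsLink e x y → Q x)
    (hPQ : ∀ x, P x → Q x → x ∈ ({u, v} : Set α))
    (hjump : ∀ s ∈ ({u, v} : Set α), ∀ t ∈ ({u, v} : Set α), ∀ h, Ω.Joins B s t h →
      Ω.Determines A s t h) (hx : P x) (hy : P y) (hj : Ω.Joins (A ∪ B) x y g) :
    Ω.Determines A x y g := by
  -- Invariant along the walk: it is on the side of `A` with its gain determined, or on an excursion
  -- in `B` that began at some `s ∈ {u, v}`.
  have main : P y ∧ Ω.Determines A x y g ∨ Q y ∧ ∃ s ∈ ({u, v} : Set α), ∃ h k,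
      Ω.Determines A x s h ∧ Ω.Joins B s y k ∧ g = h * k := by
    clear hy
    have aux {y z : α} {g k : Γ} {e : β} (hl : Ω.graph.IsLink e y z) (he : e ∈ A ∪ B)
        (hk : ∀ {X : Set β}, e ∈ X → Ω.Joins X y z k)
        (ih : P y ∧ Ω.Determines A x y g ∨ Q y ∧ ∃ s ∈ ({u, v} : Set α), ∃ h k,
          Ω.Determines A x s h ∧ Ω.Joins B s y k ∧ g = h * k) :
        P z ∧ Ω.Determines A x z (g * k) ∨ Q z ∧ ∃ s ∈ ({u, v} : Set α), ∃ h l,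
          Ω.Determines A x s h ∧ Ω.Joins B s z l ∧ g * k = h * l := by
      obtain he | he := he
      · refine .inl ⟨hA e he _ _ hl.symm, ?_⟩
        obtain ⟨-, h⟩ | ⟨hQ, s, hs, h, l, h₁, h₂, rfl⟩ := ih
        · exact h.trans (.inl (hk he))
        · have hy := hPQ y (hA e he _ _ hl) hQ
          exact (h₁.trans (hjump s hs y hy l h₂)).trans (.inl (hk he))
      · refine .inr ⟨hB e he _ _ hl.symm, ?_⟩
        obtain ⟨hP, h⟩ | ⟨hQ, s, hs, h, l, h₁, h₂, rfl⟩ := ih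
        · exact ⟨y, hPQ y hP (hB e he _ _ hl), g, k, h, hk he, rfl⟩
        · exact ⟨s, hs, h, l * k, h₁, h₂.trans (hk he), mul_assoc _ _ _⟩
    induction hj with
    | refl => exact .inl ⟨hx, .inl .refl⟩
    | step _ he hl ih => exact aux hl he (fun he ↦ .single he hl) ih
    | step_inv _ he hl ih => exact aux hl.symm he (fun he ↦ .single_inv he hl) ih
  obtain ⟨-, h⟩ | ⟨hQ, s, hs, h, k, h₁, h₂, rfl⟩ := main
  · exact h
  · exact h₁.trans (hjump s hs y (hPQ y hy hQ) k h₂)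

/-- The sets of edges `E₁` and `E₂` of a gain-graph have only the vertices `u` and `v` in common,
and they have in common an unbalanced loop at each of these, and a `uv`-edge of gain `h` whenever
both contain a balanced connection from `u` to `v` of gain `h`. -/
structure IsGluing (Ω : GainGraph α β Γ) (E₁ E₂ : Set β) (u v : α) : Prop where
  vertex : ∀ e ∈ E₁, ∀ f ∈ E₂, ∀ x, Ω.graph.Inc e x → Ω.graph.Inc f x → x ∈ ({u, v} : Set α)
  loop : ∀ x ∈ ({u, v} : Set α), ∃ e ∈ E₁ ∩ E₂, Ω.IsUnbalancedLoop e x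
  -- Balance allows the walks to be replaced by paths of the same gain, to which the path hypothesis
  -- applies.
  edge : ∀ X₁ ⊆ E₁, ∀ X₂ ⊆ E₂, ∀ h, Ω.Joins X₁ u v h → Ω.Joins X₂ u v h →
    ¬ Ω.UnbalancedAt X₁ u → ¬ Ω.UnbalancedAt X₂ u →
    ∃ e ∈ E₁ ∩ E₂, Ω.graph.IsLink e u v ∧ Ω.gain e u v = h

namespace IsGluing

lemma symm (hg : Ω.IsGluing E₁ E₂ u v) : Ω.IsGluing E₂ E₁ u v where
  vertex e he f hf x hx hx' := hg.vertex f hf e he x hx' hx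
  loop := by simpa only [Set.inter_comm] using hg.loop
  edge X₁ h₁ X₂ h₂ h hj₁ hj₂ hu₁ hu₂ := by
    simpa only [Set.inter_comm] using hg.edge X₂ h₂ X₁ h₁ h hj₂ hj₁ hu₂ hu₁

lemma exists_unbalancedLoop_mem (hg : Ω.IsGluing E₁ E₂ u v) (hY : Ω.closure Y ⊆ Y)
    (hx : x ∈ ({u, v} : Set α)) (hub : Ω.UnbalancedAt Y x) :
    ∃ e ∈ Y ∩ (E₁ ∩ E₂), Ω.IsUnbalancedLoop e x := by
  obtain ⟨e, he, hl, hgain⟩ := hg.loop x hx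
  exact ⟨e, ⟨hY ⟨x, x, hl, .inr ⟨hub, hub⟩⟩, he⟩, hl, hgain⟩

/-- This replaces a single excursion into `E₂`. The flat `Y` contains the common loops at its
unbalanced vertices among `u`, `v`. In the balanced case `hside` supplies a connection through `E₁`,
which balance forces to have the same gain, and the resulting common edge lies in `Y` because `Y` is
closed. -/
lemma determines (hg : Ω.IsGluing E₁ E₂ u v) (hY : Ω.closure Y ⊆ Y)
    (hside : Ω.Reach (Y ∩ E₂) u v → Ω.Reach (Y ∩ E₁) u v) (hA : Y ∩ (E₁ ∩ E₂) ⊆ A)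
    {s t : α} (hs : s ∈ ({u, v} : Set α)) (ht : t ∈ ({u, v} : Set α))
    (hj : Ω.Joins (Y ∩ E₂) s t h) : Ω.Determines A s t h := by
  have hss₁ : Y ∩ E₁ ⊆ Y := Set.inter_subset_left
  have hss₂ : Y ∩ E₂ ⊆ Y := Set.inter_subset_left
  have hub {x : α} (hx : x ∈ ({u, v} : Set α)) (h : Ω.UnbalancedAt Y x) : Ω.UnbalancedAt A x := by
    obtain ⟨e, he, hl, hgain⟩ := hg.exists_unbalancedLoop_mem hY hx h
    exact ⟨_, hgain, .single (hA he) hl⟩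
  have hself {x : α} (hx : x ∈ ({u, v} : Set α)) {h : Γ} (hj : Ω.Joins (Y ∩ E₂) x x h) :
      Ω.Determines A x x h := by
    obtain rfl | hne := eq_or_ne h 1
    · exact .inl .refl
    · have := hub hx ⟨h, hne, hj.mono hss₂⟩
      exact .inr ⟨this, this⟩
  have huv {h : Γ} (hj : Ω.Joins (Y ∩ E₂) u v h) : Ω.Determines A u v h := by
    by_cases hu : Ω.UnbalancedAt Y u
    · exact .inr ⟨hub (by simp) hu, hub (by simp) (hu.of_reach ⟨_, hj.mono hss₂⟩)⟩
    obtain ⟨k, hk⟩ := hside ⟨_, hj⟩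
    obtain rfl : k = h := by
      by_contra hne
      exact hu (.of_ne (hk.mono hss₁) (hj.mono hss₂) hne)
    obtain ⟨e, he, hl, rfl⟩ := hg.edge _ Set.inter_subset_right _ Set.inter_subset_right _ hk hj
      (fun h ↦ hu (h.mono hss₁)) (fun h ↦ hu (h.mono hss₂))
    exact .inl (.single (hA ⟨hY ⟨u, v, hl, .inl (hj.mono hss₂)⟩, he⟩) hl)
  obtain rfl | rfl := hs <;> obtain rfl | rfl := ht
  · exact hself (by simp) hj
  · exact huv hj
  · simpa using (huv hj.symm).symm
  · exact hself (by simp) hj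

lemma closure_union_inter_subset (hg : Ω.IsGluing E₁ E₂ u v) (hY : Ω.closure Y ⊆ Y)
    (hside : Ω.Reach (Y ∩ E₂) u v → Ω.Reach (Y ∩ E₁) u v) (hA : Y ∩ (E₁ ∩ E₂) ⊆ A)
    (hAE : A ⊆ E₁) : Ω.closure (A ∪ (Y ∩ E₂)) ∩ E₁ ⊆ Ω.closure A := by
  rintro e ⟨⟨x, y, hl, hdet⟩, he⟩
  refine ⟨x, y, hl, hdet.of_forall_joins fun s hs t ht k hj ↦ ?_⟩
  have hP {s : α} (hs : s ∈ ({x, y} : Set α)) : ∃ f ∈ E₁, Ω.graph.Inc f s := by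
    obtain rfl | rfl := hs
    · exact ⟨e, he, hl.inc_left⟩
    · exact ⟨e, he, hl.inc_right⟩
  exact hj.determines_of_union (u := u) (v := v) (P := fun s ↦ ∃ f ∈ E₁, Ω.graph.Inc f s)
    (Q := fun s ↦ ∃ f ∈ E₂, Ω.graph.Inc f s)
    (fun f hf a b hab ↦ ⟨f, hAE hf, hab.inc_left⟩) (fun f hf a b hab ↦ ⟨f, hf.2, hab.inc_left⟩)
    (fun a ⟨f, hf, hfa⟩ ⟨f', hf', hfa'⟩ ↦ hg.vertex f hf f' hf' a hfa hfa')
    (fun a ha b hb k hk ↦ hg.determines hY hside hA ha hb hk) (hP hs) (hP ht)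

lemma eRk_add_eRk (hg : Ω.IsGluing E₁ E₂ u v) (hE : E(Ω.graph).Finite)
    (hE₁₂ : E(Ω.graph) = E₁ ∪ E₂) (hY : (Ω.frameMatroid hE).IsFlat Y) :
    (Ω.frameMatroid hE).eRk Y + (Ω.frameMatroid hE).eRk (Y ∩ (E₁ ∩ E₂)) =
      (Ω.frameMatroid hE).eRk (Y ∩ E₁) + (Ω.frameMatroid hE).eRk (Y ∩ E₂) := by
  have hYE : Y ⊆ E(Ω.graph) := hY.subset_ground
  have main {E₁ E₂ : Set β} (hg : Ω.IsGluing E₁ E₂ u v) (hE₁₂ : E(Ω.graph) = E₁ ∪ E₂)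
      (hside : Ω.Reach (Y ∩ E₂) u v → Ω.Reach (Y ∩ E₁) u v) :
      (Ω.frameMatroid hE).eRk Y + (Ω.frameMatroid hE).eRk (Y ∩ (E₁ ∩ E₂)) =
        (Ω.frameMatroid hE).eRk (Y ∩ E₁) + (Ω.frameMatroid hE).eRk (Y ∩ E₂) := by
    have hcl : Ω.closure Y ⊆ Y := by
      rw [← frameMatroid_closure hE hYE, hY.closure]
    have h₁ : Y ∩ E₁ ⊆ E(Ω.graph) := Set.inter_subset_left.trans hYE
    have h₂ : Y ∩ E₂ ⊆ E(Ω.graph) := Set.inter_subset_left.trans hYE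
    have hmod := Matroid.eRk_add_eRk_of_closure_inter_subset (M := Ω.frameMatroid hE) h₁ h₂
    rw [← Set.inter_inter_distrib_left, ← Set.inter_union_distrib_left, ← hE₁₂,
      Set.inter_eq_self_of_subset_left hYE] at hmod
    refine hmod fun A hA hAY ↦ ?_
    rw [frameMatroid_closure hE (Set.union_subset (hAY.trans h₁) h₂),
      frameMatroid_closure hE (hAY.trans h₁)]
    exact (Set.inter_subset_inter_right _ Set.inter_subset_right).trans
      (hg.closure_union_inter_subset hcl hside hA (hAY.trans Set.inter_subset_right))
  -- The rank identity is symmetric in `E₁` and `E₂`, and if `hside` fails, its mirror image holds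
  -- vacuously.
  by_cases hside : Ω.Reach (Y ∩ E₂) u v → Ω.Reach (Y ∩ E₁) u v
  · exact main hg hE₁₂ hside
  · rw [Set.inter_comm E₁, add_comm (Matroid.eRk _ (Y ∩ E₁))]
    exact main hg.symm (hE₁₂.trans (Set.union_comm _ _)) (by tauto)

/-- The common part of a gluing has rank at most two. -/
lemma eRk_inter_le (hg : Ω.IsGluing E₁ E₂ u v) (hE : E(Ω.graph).Finite) :
    (Ω.frameMatroid hE).eRk (E₁ ∩ E₂) ≤ 2 := by
  obtain ⟨e, he, hel, heg⟩ := hg.loop u (by simp)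
  obtain ⟨f, hf, hfl, hfg⟩ := hg.loop v (by simp)
  have hsub : {e, f} ⊆ E(Ω.graph) := by
    rintro _ (rfl | rfl)
    · exact hel.edge_mem
    · exact hfl.edge_mem
  have hub {x : α} (hx : x ∈ ({u, v} : Set α)) : Ω.UnbalancedAt {e, f} x := by
    obtain rfl | rfl := hx
    · exact ⟨_, heg, .single (by simp) hel⟩
    · exact ⟨_, hfg, .single (by simp) hfl⟩
  have hcl : (E₁ ∩ E₂) ∩ (Ω.frameMatroid hE).E ⊆ (Ω.frameMatroid hE).closure {e, f} := by
    rw [frameMatroid_closure hE hsub]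
    rintro d ⟨⟨hd₁, hd₂⟩, hd⟩
    obtain ⟨x, y, hl⟩ := Ω.graph.exists_isLink_of_mem_edgeSet hd
    exact ⟨x, y, hl, .inr ⟨hub (hg.vertex d hd₁ d hd₂ x hl.inc_left hl.inc_left),
      hub (hg.vertex d hd₁ d hd₂ y hl.inc_right hl.inc_right)⟩⟩
  rw [← Matroid.eRk_inter_ground]
  refine (Matroid.eRk_mono _ hcl).trans ?_
  rw [Matroid.eRk_closure_eq]
  refine (Matroid.eRk_le_encard _ _).trans ((Set.encard_insert_le _ _).trans ?_)
  rw [Set.encard_singleton, one_add_one_eq_two]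

end IsGluing

/-! ### The two gain-graphs as restrictions of their amalgam -/

/-- `Ω'` is a part of `Ω`: its edges are edges of `Ω` with the same ends and gains. -/
def IsPart (Ω' Ω : GainGraph α β Γ) : Prop :=
  ∀ e ∈ E(Ω'.graph), ∀ x y, (Ω.graph.IsLink e x y ↔ Ω'.graph.IsLink e x y) ∧
    (Ω'.graph.IsLink e x y → Ω.gain e x y = Ω'.gain e x y)

namespace IsPart

lemma joins_iff (hp : Ω'.IsPart Ω) (hX : X ⊆ E(Ω'.graph)) :
    Ω.Joins X x y g ↔ Ω'.Joins X x y g := by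
  constructor
  · intro hj
    induction hj with
    | refl => exact .refl
    | step _ he hl ih =>
      have hl' := (hp _ (hX he) _ _).1.1 hl
      rw [(hp _ (hX he) _ _).2 hl']
      exact ih.step he hl'
    | step_inv _ he hl ih =>
      have hl' := (hp _ (hX he) _ _).1.1 hl
      rw [(hp _ (hX he) _ _).2 hl']
      exact ih.step_inv he hl'
  · intro hj
    induction hj with
    | refl => exact .refl
    | step _ he hl ih =>
      rw [← (hp _ (hX he) _ _).2 hl]
      exact ih.step he ((hp _ (hX he) _ _).1.2 hl)
    | step_inv _ he hl ih =>
      rw [← (hp _ (hX he) _ _).2 hl]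
      exact ih.step_inv he ((hp _ (hX he) _ _).1.2 hl)

lemma unbalancedAt_iff (hp : Ω'.IsPart Ω) (hX : X ⊆ E(Ω'.graph)) :
    Ω.UnbalancedAt X x ↔ Ω'.UnbalancedAt X x := by
  simp only [UnbalancedAt, hp.joins_iff hX]

lemma mem_closure_iff (hp : Ω'.IsPart Ω) (hX : X ⊆ E(Ω'.graph)) (he : e ∈ E(Ω'.graph)) :
    e ∈ Ω.closure X ↔ e ∈ Ω'.closure X := by
  obtain ⟨x, y, hl⟩ := Ω'.graph.exists_isLink_of_mem_edgeSet he
  rw [GainGraph.mem_closure_iff hl, GainGraph.mem_closure_iff ((hp e he x y).1.2 hl), Determines,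
    Determines, hp.joins_iff hX, hp.unbalancedAt_iff hX, hp.unbalancedAt_iff hX,
    (hp e he x y).2 hl]

lemma frameMatroid_restrict (hp : Ω'.IsPart Ω) (hE : E(Ω.graph).Finite)
    (hE' : E(Ω'.graph).Finite) :
    (Ω.frameMatroid hE).restrict E(Ω'.graph) = Ω'.frameMatroid hE' := by
  refine Matroid.ext_indep rfl fun I (hI : I ⊆ E(Ω'.graph)) ↦ ?_
  have hIE : I ⊆ E(Ω.graph) := by
    intro e he
    obtain ⟨x, y, hl⟩ := Ω'.graph.exists_isLink_of_mem_edgeSet (hI he)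
    exact ((hp e (hI he) x y).1.2 hl).edge_mem
  rw [Matroid.restrict_indep_iff, frameMatroid_indep_iff, frameMatroid_indep_iff,
    and_iff_left hI, and_iff_right hI, and_iff_right hIE]
  refine forall₂_congr fun e he ↦ not_congr ?_
  exact hp.mem_closure_iff (Set.sdiff_subset.trans hI) (hI he)

end IsPart

namespace Amalgamable

variable {Ω₁ Ω₂ : GainGraph α β Γ}

lemma isLink_iff (h : Ω₁.Amalgamable Ω₂ u v) (h₁ : e ∈ E(Ω₁.graph)) (h₂ : e ∈ E(Ω₂.graph)) :
    Ω₁.graph.IsLink e x y ↔ Ω₂.graph.IsLink e x y := by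
  have h₃ : (Ω₁.graph.edgeInduced (E(Ω₁.graph) ∩ E(Ω₂.graph))).IsLink e x y ↔
    (Ω₂.graph.edgeInduced (E(Ω₁.graph) ∩ E(Ω₂.graph))).IsLink e x y := by
    rw [h.edgeInduced_eq]
  exact (and_iff_right (show e ∈ E(Ω₁.graph) ∩ E(Ω₂.graph) from ⟨h₁, h₂⟩)).symm.trans
    (h₃.trans (and_iff_right ⟨h₁, h₂⟩))

lemma isPart_left (h : Ω₁.Amalgamable Ω₂ u v) : Ω₁.IsPart (Ω₁.amalgam Ω₂ h) := by
  refine fun e he x y ↦ ⟨⟨?_, .inl⟩, fun hl ↦ if_pos hl⟩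
  rintro (hl | hl)
  · exact hl
  · exact (h.isLink_iff he hl.edge_mem).2 hl

lemma isPart_right (h : Ω₁.Amalgamable Ω₂ u v) : Ω₂.IsPart (Ω₁.amalgam Ω₂ h) := by
  refine fun e he x y ↦ ⟨⟨?_, .inr⟩, fun hl ↦ ?_⟩
  · rintro (hl | hl)
    · exact (h.isLink_iff hl.edge_mem he).1 hl
    · exact hl
  · by_cases hl₁ : Ω₁.graph.IsLink e x y
    · exact (if_pos hl₁).trans (h.gain_eq e x y hl₁ hl)
    · exact if_neg hl₁

end Amalgamable

/-- Any path in `X` from `x` to `y` will do: a gain other than `g` would make `X` unbalanced at `x`.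
-/
lemma Joins.exists_isPath (hj : Ω.Joins X x y g) (hx : x ∈ V(Ω.graph))
    (hub : ¬ Ω.UnbalancedAt X x) : ∃ w : Ω.graph.Walk x y, w.IsPath ∧ Ω.walkGain w = g := by
  obtain ⟨w, hw, hwX⟩ := Reach.exists_isPath ⟨g, hj⟩ hx
  refine ⟨w, hw, ?_⟩
  by_contra hne
  exact hub (.of_ne (joins_walkGain w hwX) hj hne)

end GainGraph

/-! ### The proper amalgam -/

theorem mainTheorem7 {α β Γ : Type*} [Group Γ] (Ω₁ Ω₂ : GainGraph α β Γ) (u v : α)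
    (hE₁ : Ω₁.graph.edgeSet.Finite) (hE₂ : Ω₂.graph.edgeSet.Finite)
    (huv : u ≠ v)
    (h : Ω₁.Amalgamable Ω₂ u v)
    (hloop_u : ∃ e ∈ Ω₁.graph.edgeSet ∩ Ω₂.graph.edgeSet, Ω₁.IsUnbalancedLoop e u)
    (hloop_v : ∃ e ∈ Ω₁.graph.edgeSet ∩ Ω₂.graph.edgeSet, Ω₁.IsUnbalancedLoop e v)
    (hpath : ∀ (P₁ : Ω₁.graph.Walk u v) (P₂ : Ω₂.graph.Walk u v), P₁.IsPath → P₂.IsPath →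
      Ω₁.walkGain P₁ = Ω₂.walkGain P₂ →
      ∃ e ∈ Ω₁.graph.edgeSet ∩ Ω₂.graph.edgeSet,
        Ω₁.graph.IsLink e u v ∧ Ω₂.graph.IsLink e u v ∧
          Ω₁.gain e u v = Ω₁.walkGain P₁ ∧ Ω₂.gain e u v = Ω₂.walkGain P₂) :
    ∃ M₁ M₂ M : Matroid β, Ω₁.IsFrameMatroid M₁ ∧ Ω₂.IsFrameMatroid M₂ ∧
      (Ω₁.amalgam Ω₂ h).IsFrameMatroid M ∧ Matroid.IsProperAmalgam M₁ M₂ M := by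
  have hp₁ := h.isPart_left
  have hp₂ := h.isPart_right
  set Ω := Ω₁.amalgam Ω₂ h
  have hEΩ : E(Ω.graph) = E(Ω₁.graph) ∪ E(Ω₂.graph) := rfl
  have hE : E(Ω.graph).Finite := hE₁.union hE₂
  have hu₁ : u ∈ V(Ω₁.graph) ∩ V(Ω₂.graph) := h.vertexSet_inter ▸ .inl rfl
  have hinc₁ {e : β} {x : α} (he : e ∈ E(Ω₁.graph)) (hx : Ω.graph.Inc e x) :
      x ∈ V(Ω₁.graph) := by
    obtain ⟨y, hl⟩ := hx
    exact ((hp₁ e he x y).1.1 hl).left_mem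
  have hinc₂ {e : β} {x : α} (he : e ∈ E(Ω₂.graph)) (hx : Ω.graph.Inc e x) :
      x ∈ V(Ω₂.graph) := by
    obtain ⟨y, hl⟩ := hx
    exact ((hp₂ e he x y).1.1 hl).left_mem
  have hloop {x : α} (hx : ∃ e ∈ E(Ω₁.graph) ∩ E(Ω₂.graph), Ω₁.IsUnbalancedLoop e x) :
      ∃ e ∈ E(Ω₁.graph) ∩ E(Ω₂.graph), Ω.IsUnbalancedLoop e x := by
    obtain ⟨e, he, hl, hg⟩ := hx
    exact ⟨e, he, (hp₁ e he.1 x x).1.2 hl, by rwa [(hp₁ e he.1 x x).2 hl]⟩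
  have hglue : Ω.IsGluing E(Ω₁.graph) E(Ω₂.graph) u v := by
    refine ⟨?_, ?_, ?_⟩
    · intro e he f hf x hx hx'
      rw [← h.vertexSet_inter]
      exact ⟨hinc₁ he hx, hinc₂ hf hx'⟩
    · rintro x (rfl | rfl)
      · exact hloop hloop_u
      · exact hloop hloop_v
    · intro X₁ hX₁ X₂ hX₂ k hj₁ hj₂ hub₁ hub₂
      rw [hp₁.joins_iff hX₁] at hj₁
      rw [hp₂.joins_iff hX₂] at hj₂
      rw [hp₁.unbalancedAt_iff hX₁] at hub₁
      rw [hp₂.unbalancedAt_iff hX₂] at hub₂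
      obtain ⟨w₁, hw₁, hg₁⟩ := hj₁.exists_isPath hu₁.1 hub₁
      obtain ⟨w₂, hw₂, hg₂⟩ := hj₂.exists_isPath hu₁.2 hub₂
      obtain ⟨e, he, hl, -, hg, -⟩ := hpath w₁ w₂ hw₁ hw₂ (hg₁.trans hg₂.symm)
      exact ⟨e, he, (hp₁ e he.1 u v).1.2 hl, ((hp₁ e he.1 u v).2 hl).trans (hg.trans hg₁)⟩
  refine ⟨Ω₁.frameMatroid hE₁, Ω₂.frameMatroid hE₂, Ω.frameMatroid hE,
    GainGraph.isFrameMatroid_frameMatroid hE₁, GainGraph.isFrameMatroid_frameMatroid hE₂,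
    GainGraph.isFrameMatroid_frameMatroid hE, ?_⟩
  rw [← hp₁.frameMatroid_restrict hE hE₁, ← hp₂.frameMatroid_restrict hE hE₂]
  set M := Ω.frameMatroid hE
  have hcap : (M.restrict E(Ω₁.graph)).restrict (E(Ω₁.graph) ∩ E(Ω₂.graph)) =
      M.restrict (E(Ω₁.graph) ∩ E(Ω₂.graph)) := M.restrict_restrict_eq Set.inter_subset_left
  have hcap' : (M.restrict E(Ω₂.graph)).restrict (E(Ω₁.graph) ∩ E(Ω₂.graph)) =
      M.restrict (E(Ω₁.graph) ∩ E(Ω₂.graph)) := M.restrict_restrict_eq Set.inter_subset_right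
  refine
    { ground_eq := rfl
      restrict_left := rfl
      restrict_right := rfl
      finite := hE
      restrict_eq := hcap.trans hcap'.symm
      isModular := ?_
      rank_le := fun X Y hXY hY ↦ ?_
      -- The minimum is attained at the flat spanned by `X`, which has the same rank as `X`.
      exists_rank_eq := fun X hX ↦ ⟨M.closure X, M.subset_closure X hX,
        M.closure_subset_ground X, ?_⟩ }
  · simp only [Matroid.restrict_ground_eq, hcap]
    exact Matroid.isModular_of_eRank_le_two (hglue.eRk_inter_le hE)
  · simp only [Matroid.restrict_ground_eq, hcap]
    rw [Matroid.restrict_eRk_eq _ Set.inter_subset_right,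
      Matroid.restrict_eRk_eq _ Set.inter_subset_right,
      Matroid.restrict_eRk_eq _ Set.inter_subset_right]
    have hsub := M.eRk_inter_add_eRk_union_le (Y ∩ E(Ω₁.graph)) (Y ∩ E(Ω₂.graph))
    rw [← Set.inter_inter_distrib_left, ← Set.inter_union_distrib_left,
      Set.inter_eq_self_of_subset_left (show Y ⊆ E(Ω₁.graph) ∪ E(Ω₂.graph) from hY),
      add_comm] at hsub
    exact (add_le_add_left (M.eRk_mono hXY) _).trans hsub
  · simp only [Matroid.restrict_ground_eq, hcap]
    rw [Matroid.restrict_eRk_eq _ Set.inter_subset_right,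
      Matroid.restrict_eRk_eq _ Set.inter_subset_right,
      Matroid.restrict_eRk_eq _ Set.inter_subset_right, ← M.eRk_closure_eq]
    exact hglue.eRk_add_eRk hE hEΩ (M.isFlat_closure X)
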